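/- **Setting.** Let $d,n,m,s,t\in\mathbb N$. The two-frame group $\mathrm{TFG}(d,n,m)$ is the set $SO(d)\times\mathbb R^{d\times n}\times\mathbb R^{d\times m}$ with product $(R,x,y)(R',x',y')=(RR',\,x+Rx',\,R'^{-1}y+y')$. Put $r=[x,\ Ry]\in\mathbb R^{d\times(n+m)}$ and identify $T=(R,x,y)$ with the matrix $\begin{bmatrix}R&r\\0&I\end{bmatrix}$. The multi-frame group $G=\mathrm{MFG}(d,n,m,s,t)$ consists of the tuples $\chi=(T_0;{}^lT_1,\dots,{}^lT_s;{}^rT_1,\dots,{}^rT_t)$ of elements of $\mathrm{TFG}(d,n,m)$, with the group law for which $$\chi\mapsto\operatorname{diag}\bigl(T_0\,\big|\,{}^lT_j\cdots{}^lT_1T_0\ (1\le j\le s)\,\big|\,T_0{}^rT_1\cdots{}^rT_j\ (1\le j\le t)\bigr)$$ is multiplicative (the semi-direct product built on the inner automorphisms of $\mathrm{TFG}$). Write ${}^{(\cdot)}T_j=({}^{(\cdot)}R_j,{}^{(\cdot)}r_j)$ and ${}^lT_0={}^rT_0=T_0$. Let ${}^{(\cdot)}\bar R_{i,j}$ be the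 product of the ${}^{(\cdot)}R_k$ from $k=i$ to $k=j$, with ascending indices if $i\le j$ and descending indices if $i>j$, and let $\mathrm{Ad}_R A=RAR^{-1}$. A dynamics $\dot\chi=f_u(\chi)$ with inputs $u$ in a set $U$ is given by continuous vector fields $f_u$ on $G$. It is *group affine* if $f_u(ab)=f_u(a)b+af_u(b)-af_u(\mathrm{id})b$ for all $u\in U$, $a,b\in G$. A map $F:G\to G$ is *compatible with automorphisms* if $F(\chi_0)=\psi(\chi_0)F(\mathrm{id})$ for some (continuous, equivalently smooth) automorphism $\psi$ of $G$. The dynamics is *flow-compatible* if for each constant input $u$ it has a global flow $(\Phi^\tau)_{\tau\in\mathbb R}$, a one-parameter group, with every $\Phi^\tau$ compatible with automorphisms. A dynamics *has the explicit form* if there are functions of $u$: skew-symmetric $d\times d$ matrices ${}^l\theta_j^\times$ $(0\le j\le s)$, ${}^l\omega_j^\times$ $(1\le j\le s)$, ${}^r\theta_j^\times$ $(1\le j\le t)$, ${}^r\omega_j^\times$ $(0\le j\le t)$; $d\times(n+m)$ matrices ${}^l\gamma_j$ $(0\le j\le s)$, ${}^l\rho_j$ $(1\le j\le s)$, ${}^r\gamma_j$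 $(1\le j\le t)$, ${}^r\rho_j$ $(0\le j\le t)$; and $(n+m)\times(n+m)$ matrices ${}^lL_j$ $(0\le j\le s)$, ${}^rL_j$ $(0\le j\le t)$ with ${}^lL_0=-{}^rL_0$, such that, with ${}^{(\cdot)}\bar L_j={}^{(\cdot)}L_{j-1}-{}^{(\cdot)}L_j$, the dynamics reads $$\dot R_0={}^l\theta_0^\times R_0+R_0{}^r\omega_0^\times,$$ $${}^l\dot R_j={}^l\theta_j^\times{}^lR_j+{}^lR_j\bigl[\mathrm{Ad}_{{}^l\bar R_{j-1,0}}({}^l\omega_j^\times)-{}^l\theta_{j-1}^\times\bigr]\quad(1\le j\le s),$$ $${}^r\dot R_j=\bigl[\mathrm{Ad}^{-1}_{{}^r\bar R_{0,j-1}}({}^r\theta_j^\times)-{}^r\omega_{j-1}^\times\bigr]{}^rR_j+{}^rR_j{}^r\omega_j^\times\quad(1\le j\le t),$$ $$\dot r_0={}^l\theta_0^\times r_0+{}^l\gamma_0+R_0{}^r\rho_0+r_0{}^rL_0,$$ $${}^l\dot r_j=\sum_{k=0}^{j-1}{}^l\bar R_{j,k+1}\bigl[{}^lr_k{}^l\bar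 L_j-\mathrm{Ad}_{{}^l\bar R_{k,0}}({}^l\omega_j^\times){}^lr_k\bigr]+{}^l\gamma_j+{}^l\bar R_{j,0}{}^l\rho_j+{}^l\theta_j^\times{}^lr_j-{}^lR_j{}^l\gamma_{j-1}-{}^lr_j{}^lL_j\quad(1\le j\le s),$$ $$\begin{aligned}{}^r\dot r_j={}&{}^r\bar R_{0,j-1}^{-1}{}^r\theta_j^\times r_0+\sum_{k=1}^{j-1}{}^r\bar R_{k,j-1}^{-1}\mathrm{Ad}^{-1}_{{}^r\bar R_{0,k-1}}({}^r\theta_j^\times){}^rr_k+\mathrm{Ad}^{-1}_{{}^r\bar R_{0,j-1}}({}^r\theta_j^\times){}^rr_j-{}^r\rho_{j-1}\\&-\sum_{k=0}^{j-1}{}^r\bar R_{k,j-1}^{-1}{}^rr_k{}^r\bar L_j+{}^rR_j{}^r\rho_j+{}^rr_j{}^rL_j-{}^r\omega_{j-1}^\times{}^rr_j+{}^r\bar R_{0,j-1}^{-1}{}^r\gamma_j\quad(1\le j\le t).\end{aligned}$$ **Theorem.** 1. Every dynamics of the explicit form (with arbitrary parameter functions of $u$) is group affine and flow-compatible. 2.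 Exclude the low-dimensional cases "$d=2$ and $n+m\ge2$" and "$d=1$, $n+m\ge1$ and $s+t\ge1$". Then every group affine dynamics, and every flow-compatible dynamics, has the explicit form. Moreover, if for a time-varying input $\tau\mapsto u_\tau$ the equation $\dot\chi=f_{u_\tau}(\chi)$ (each $f_{u_\tau}$ continuous) has a flow $\Phi^\tau$ on $G$ defined for all $\tau\in\mathbb R$ from time $0$ with every $\Phi^\tau$ compatible with automorphisms, then the fields $f_{u_\tau}$ have the explicit form, with parameters that are functions of $u_\tau$. 3. For $j=0$ the equations are the natural two-frame vector dynamics: split $r_0=[x_0,R_0y_0]$, ${}^l\gamma_0=[\alpha,\beta]$, ${}^r\rho_0=[\xi,\eta]$, ${}^rL_0=\begin{bmatrix}L_A&L_B\\L_C&L_D\end{bmatrix}$ into blocks of sizes $n$ and $m$. If $R_0$ satisfies its equation, then the equation for $r_0$ is equivalent to $$\dot x_0={}^l\theta_0^\times x_0+\alpha+R_0[\xi+y_0L_C]+x_0L_A,\qquad \dot y_0=-{}^r\omega_0^\times y_0+R_0^{-1}[\beta+x_0L_B]+\eta+y_0L_D.$$ -/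

import Mathlib

namespace MultiFrame

/-! ### The two-frame group -/

/-- The rotation group `SO(d)`. -/
abbrev SO (d : ℕ) := Matrix.specialOrthogonalGroup (Fin d) ℝ

/-- The Lie algebra of real skew-symmetric `d × d` matrices, i.e. the image of the
linear isomorphism `θ ↦ θ^×` from `ℝ^{d(d-1)/2}`. -/
abbrev Skew (d : ℕ) := LieAlgebra.Orthogonal.so (Fin d) ℝ

/-- The two-frame group `TFG(d,n,m)`: a rotation `R`, `n` world-frame vectors (the columns
of `x`) and `m` body-frame vectors (the columns of `y`). -/
@[ext]
structure TFG (d n m : ℕ) where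
  R : SO d
  x : Matrix (Fin d) (Fin n) ℝ
  y : Matrix (Fin d) (Fin m) ℝ

namespace TFG

variable {d n m : ℕ}

instance : Mul (TFG d n m) where
  mul a b :=
    { R := a.R * b.R
      x := a.x + (a.R : Matrix (Fin d) (Fin d) ℝ) * b.x
      y := ((b.R⁻¹ : SO d) : Matrix (Fin d) (Fin d) ℝ) * a.y + b.y }

instance : One (TFG d n m) where
  one := { R := 1, x := 0, y := 0 }

instance : Inv (TFG d n m) where
  inv a :=
    { R := a.R⁻¹
      x := -(((a.R⁻¹ : SO d) : Matrix (Fin d) (Fin d) ℝ) * a.x)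
      y := -((a.R : Matrix (Fin d) (Fin d) ℝ) * a.y) }

theorem mul_def (a b : TFG d n m) : a * b =
    { R := a.R * b.R
      x := a.x + (a.R : Matrix (Fin d) (Fin d) ℝ) * b.x
      y := ((b.R⁻¹ : SO d) : Matrix (Fin d) (Fin d) ℝ) * a.y + b.y } := rfl

theorem one_def : (1 : TFG d n m) = { R := 1, x := 0, y := 0 } := rfl

theorem inv_def (a : TFG d n m) : a⁻¹ =
    { R := a.R⁻¹
      x := -(((a.R⁻¹ : SO d) : Matrix (Fin d) (Fin d) ℝ) * a.x)
      y := -((a.R : Matrix (Fin d) (Fin d) ℝ) * a.y) } := rfl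

theorem coe_inv_mul (R : SO d) :
    ((R⁻¹ : SO d) : Matrix (Fin d) (Fin d) ℝ) * (R : Matrix (Fin d) (Fin d) ℝ) = 1 := by
  rw [← Submonoid.coe_mul, inv_mul_cancel, Submonoid.coe_one]

instance : Group (TFG d n m) :=
  Group.ofLeftAxioms
    (by
      intro a b c
      simp only [mul_def, mul_inv_rev, Submonoid.coe_mul]
      ext1
      · exact mul_assoc _ _ _
      · simp only [Matrix.mul_add, Matrix.mul_assoc, add_assoc]
      · simp only [Matrix.mul_add, Matrix.mul_assoc, add_assoc])
    (by
      intro a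
      simp only [mul_def, one_def]
      ext1 <;> simp)
    (by
      intro a
      simp only [mul_def, one_def, inv_def]
      ext1
      · exact inv_mul_cancel _
      · exact neg_add_cancel _
      · simp only [Matrix.mul_neg, ← Matrix.mul_assoc, coe_inv_mul, Matrix.one_mul]
        exact neg_add_cancel _)

/-- The vector component `r = [x, R y]`. -/
def r (T : TFG d n m) : Matrix (Fin d) (Fin n ⊕ Fin m) ℝ :=
  Matrix.fromCols T.x ((T.R : Matrix (Fin d) (Fin d) ℝ) * T.y)

/-- The matrix embedding `T = [R, r; 0, I]`. -/
def toMat (T : TFG d n m) : Matrix (Fin d ⊕ (Fin n ⊕ Fin m)) (Fin d ⊕ (Fin n ⊕ Fin m)) ℝ :=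
  Matrix.fromBlocks (T.R : Matrix (Fin d) (Fin d) ℝ) T.r 0 1

/-- The manifold topology of `SO(d) × ℝ^{d×n} × ℝ^{d×m}`. -/
instance : TopologicalSpace (TFG d n m) :=
  TopologicalSpace.induced (fun T => (T.R, T.x, T.y)) inferInstance

end TFG

/-! ### The type-II semi-direct product extension along inner automorphisms -/

/-- The underlying set `G × G^s × G^t`. -/
@[ext]
structure TypeII (G : Type*) (s t : ℕ) where
  core : G
  left : Fin s → G
  right : Fin t → G

namespace TypeII

variable {G : Type*} [Group G] {s t : ℕ}

/-- `ˡg₀ = g₀` (the core), `ˡg₁, …, ˡg_s` (the left factors); continued by `1`. -/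
def lseq (χ : TypeII G s t) : ℕ → G
  | 0 => χ.core
  | i + 1 => if h : i < s then χ.left ⟨i, h⟩ else 1

/-- `ʳg₀ = g₀` (the core), `ʳg₁, …, ʳg_t` (the right factors); continued by `1`. -/
def rseq (χ : TypeII G s t) : ℕ → G
  | 0 => χ.core
  | i + 1 => if h : i < t then χ.right ⟨i, h⟩ else 1

/-- `ˡg_j ⋯ ˡg₁ g₀`. -/
def lchain (χ : TypeII G s t) : ℕ → G
  | 0 => χ.core
  | i + 1 => χ.lseq (i + 1) * lchain χ i

/-- `g₀ ʳg₁ ⋯ ʳg_j`. -/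
def rchain (χ : TypeII G s t) : ℕ → G
  | 0 => χ.core
  | i + 1 => rchain χ i * χ.rseq (i + 1)

/-- With `φ = MulAut.conj`, which is multiplicative, the composite
`φ_{ˡg_{j-1}} ∘ ⋯ ∘ φ_{g₀}` is `φ` of the chain `ˡg_{j-1} ⋯ g₀`, and
`φ⁻¹_{ʳg_{j-1}} ∘ ⋯ ∘ φ⁻¹_{g₀}` is the inverse of `φ` of the chain `g₀ ⋯ ʳg_{j-1}`. -/
instance : Mul (TypeII G s t) where
  mul a b :=
    { core := a.core * b.core
      left := fun j => a.left j * MulAut.conj (a.lchain j) (b.left j)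
      right := fun j => (MulAut.conj (b.rchain j))⁻¹ (a.right j) * b.right j }

instance : One (TypeII G s t) where
  one := { core := 1, left := fun _ => 1, right := fun _ => 1 }

instance : Inv (TypeII G s t) where
  inv a :=
    { core := a.core⁻¹
      left := fun j => (MulAut.conj (a.lchain j))⁻¹ (a.left j)⁻¹
      right := fun j => MulAut.conj (a.rchain j) (a.right j)⁻¹ }

theorem lchain_mul (a b : TypeII G s t) (j : ℕ) :
    (a * b).lchain j = a.lchain j * b.lchain j := by
  induction j with
  | zero => rfl
  | succ i ih =>
    simp only [lchain, ih]
    by_cases h : i < s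
    · have : (a * b).lseq (i + 1) =
          a.lseq (i + 1) * (a.lchain i * b.lseq (i + 1) * (a.lchain i)⁻¹) := by
        simp only [lseq, h, dite_true]; rfl
      rw [this]; group
    · simp [lseq, h]

theorem rchain_mul (a b : TypeII G s t) (j : ℕ) :
    (a * b).rchain j = a.rchain j * b.rchain j := by
  induction j with
  | zero => rfl
  | succ i ih =>
    simp only [rchain, ih]
    by_cases h : i < t
    · have : (a * b).rseq (i + 1) =
          ((b.rchain i)⁻¹ * a.rseq (i + 1) * b.rchain i) * b.rseq (i + 1) := by
        simp only [rseq, h, dite_true]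
        change (MulAut.conj (b.rchain i))⁻¹ (a.right ⟨i, h⟩) * b.right ⟨i, h⟩ = _
        rw [MulAut.conj_inv_apply]
      rw [this]; group
    · simp [rseq, h]

theorem lchain_one (j : ℕ) : (1 : TypeII G s t).lchain j = 1 := by
  induction j with
  | zero => rfl
  | succ i ih =>
    simp only [lchain, ih, mul_one, lseq]
    split <;> rfl

theorem rchain_one (j : ℕ) : (1 : TypeII G s t).rchain j = 1 := by
  induction j with
  | zero => rfl
  | succ i ih =>
    simp only [rchain, ih, one_mul, rseq]
    split <;> rfl

theorem lchain_inv (a : TypeII G s t) (j : ℕ) : a⁻¹.lchain j = (a.lchain j)⁻¹ := by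
  induction j with
  | zero => rfl
  | succ i ih =>
    simp only [lchain, ih]
    by_cases h : i < s
    · have : a⁻¹.lseq (i + 1) = (a.lchain i)⁻¹ * (a.lseq (i + 1))⁻¹ * a.lchain i := by
        simp only [lseq, h, dite_true]
        change (MulAut.conj (a.lchain i))⁻¹ (a.left ⟨i, h⟩)⁻¹ = _
        rw [MulAut.conj_inv_apply]
      rw [this]; group
    · simp [lseq, h]

theorem rchain_inv (a : TypeII G s t) (j : ℕ) : a⁻¹.rchain j = (a.rchain j)⁻¹ := by
  induction j with
  | zero => rfl
  | succ i ih =>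
    simp only [rchain, ih]
    by_cases h : i < t
    · have : a⁻¹.rseq (i + 1) = a.rchain i * (a.rseq (i + 1))⁻¹ * (a.rchain i)⁻¹ := by
        simp only [rseq, h, dite_true]; rfl
      rw [this]; group
    · simp [rseq, h]

theorem ext_chain {a b : TypeII G s t} (hl : ∀ j, a.lchain j = b.lchain j)
    (hr : ∀ j, a.rchain j = b.rchain j) : a = b := by
  ext j
  · exact hl 0
  · have h := hl (j + 1)
    simp only [lchain, hl j, lseq, j.isLt, dite_true] at h
    exact mul_right_cancel h
  · have h := hr (j + 1)
    simp only [rchain, hr j, rseq, j.isLt, dite_true] at h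
    exact mul_left_cancel h

instance : Group (TypeII G s t) :=
  Group.ofLeftAxioms
    (fun a b c => ext_chain (fun j => by simp only [lchain_mul, mul_assoc])
      (fun j => by simp only [rchain_mul, mul_assoc]))
    (fun a => ext_chain (fun j => by simp only [lchain_mul, lchain_one, one_mul])
      (fun j => by simp only [rchain_mul, rchain_one, one_mul]))
    (fun a => ext_chain
      (fun j => by simp only [lchain_mul, lchain_one, lchain_inv, inv_mul_cancel])
      (fun j => by simp only [rchain_mul, rchain_one, rchain_inv, inv_mul_cancel]))

instance [TopologicalSpace G] : TopologicalSpace (TypeII G s t) :=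
  TopologicalSpace.induced (fun χ => (χ.core, χ.left, χ.right)) inferInstance

end TypeII

/-! ### The multi-frame group, velocities and dynamics -/

/-- The multi-frame group `MFG(d,n,m,s,t)`. -/
abbrev MFG (d n m s t : ℕ) := TypeII (TFG d n m) s t

/-- A velocity `(Ṙ, ṙ)` of one `TFG` factor. -/
abbrev TFGVel (d n m : ℕ) := Matrix (Fin d) (Fin d) ℝ × Matrix (Fin d) (Fin n ⊕ Fin m) ℝ

/-- A velocity of all the factors: the core, the left ones `1, …, s` and the right ones
`1, …, t`. -/
abbrev MFGVel (d n m s t : ℕ) :=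
  TFGVel d n m × (Fin s → TFGVel d n m) × (Fin t → TFGVel d n m)

section Dynamics

variable {d n m s t : ℕ}

/-- `V` is tangent to `TFG` at `T`: `R⁻¹ Ṙ` is skew-symmetric. -/
def IsTangentTFG (T : TFG d n m) (V : TFGVel d n m) : Prop :=
  ((T.R⁻¹ : SO d) : Matrix (Fin d) (Fin d) ℝ) * V.1 ∈ Skew d

/-- `V` is tangent to `MFG` at `χ`. -/
def IsTangent (χ : MFG d n m s t) (V : MFGVel d n m s t) : Prop :=
  IsTangentTFG χ.core V.1 ∧ (∀ j, IsTangentTFG (χ.left j) (V.2.1 j)) ∧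
    ∀ j, IsTangentTFG (χ.right j) (V.2.2 j)

/-- Entrywise derivative of a matrix-valued curve. -/
def HasMatDerivAt {α β : Type*} (M : ℝ → Matrix α β ℝ) (M' : Matrix α β ℝ) (τ : ℝ) : Prop :=
  ∀ i j, HasDerivAt (fun σ => M σ i j) (M' i j) τ

/-- The curve `T` has velocity `V` at time `τ`. -/
def HasVelTFG (T : ℝ → TFG d n m) (V : TFGVel d n m) (τ : ℝ) : Prop :=
  HasMatDerivAt (fun σ => ((T σ).R : Matrix (Fin d) (Fin d) ℝ)) V.1 τ ∧
    HasMatDerivAt (fun σ => (T σ).r) V.2 τ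

/-- The curve `χ` has velocity `V` at time `τ`. -/
def HasVel (χ : ℝ → MFG d n m s t) (V : MFGVel d n m s t) (τ : ℝ) : Prop :=
  HasVelTFG (fun σ => (χ σ).core) V.1 τ ∧
    (∀ j, HasVelTFG (fun σ => (χ σ).left j) (V.2.1 j) τ) ∧
    ∀ j, HasVelTFG (fun σ => (χ σ).right j) (V.2.2 j) τ

/-- The time derivative `[Ṙ, ṙ; 0, 0]` of the matrix embedding of a `TFG` factor. -/
def velMat (V : TFGVel d n m) :
    Matrix (Fin d ⊕ (Fin n ⊕ Fin m)) (Fin d ⊕ (Fin n ⊕ Fin m)) ℝ :=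
  Matrix.fromBlocks V.1 V.2 0 0

/-- The velocity of the `j`-th left factor; the core for `j = 0`. -/
def lvel (V : MFGVel d n m s t) : ℕ → TFGVel d n m
  | 0 => V.1
  | i + 1 => if h : i < s then V.2.1 ⟨i, h⟩ else 0

/-- The velocity of the `j`-th right factor; the core for `j = 0`. -/
def rvel (V : MFGVel d n m s t) : ℕ → TFGVel d n m
  | 0 => V.1
  | i + 1 => if h : i < t then V.2.2 ⟨i, h⟩ else 0

/-- The diagonal block `ˡT_j ⋯ ˡT₁ T₀` of the matrix embedding of `MFG`. -/
def lblock (χ : MFG d n m s t) (j : ℕ) :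
    Matrix (Fin d ⊕ (Fin n ⊕ Fin m)) (Fin d ⊕ (Fin n ⊕ Fin m)) ℝ :=
  (χ.lchain j).toMat

/-- The diagonal block `T₀ ʳT₁ ⋯ ʳT_j` of the matrix embedding of `MFG`. -/
def rblock (χ : MFG d n m s t) (j : ℕ) :
    Matrix (Fin d ⊕ (Fin n ⊕ Fin m)) (Fin d ⊕ (Fin n ⊕ Fin m)) ℝ :=
  (χ.rchain j).toMat

/-- The time derivative of `lblock χ j` along the velocity `V` (product rule). -/
def lblockVel (χ : MFG d n m s t) (V : MFGVel d n m s t) :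
    ℕ → Matrix (Fin d ⊕ (Fin n ⊕ Fin m)) (Fin d ⊕ (Fin n ⊕ Fin m)) ℝ
  | 0 => velMat V.1
  | i + 1 => velMat (lvel V (i + 1)) * lblock χ i + (χ.lseq (i + 1)).toMat * lblockVel χ V i

/-- The time derivative of `rblock χ j` along the velocity `V` (product rule). -/
def rblockVel (χ : MFG d n m s t) (V : MFGVel d n m s t) :
    ℕ → Matrix (Fin d ⊕ (Fin n ⊕ Fin m)) (Fin d ⊕ (Fin n ⊕ Fin m)) ℝ
  | 0 => velMat V.1
  | i + 1 => rblockVel χ V i * (χ.rseq (i + 1)).toMat + rblock χ i * velMat (rvel V (i + 1))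

/-- The dynamics `χ̇ = f_u(χ)` is group affine: each `f_u` is a continuous vector field on
`MFG` with `f_u(ab) = f_u(a) b + a f_u(b) - a f_u(1) b`, where the products of group elements
and tangent vectors are products of block-diagonal matrices in the matrix embedding
`diag(T₀ | ˡT_j ⋯ T₀ | T₀ ⋯ ʳT_j)`. -/
structure IsGroupAffine {U : Type*} (f : U → MFG d n m s t → MFGVel d n m s t) : Prop where
  continuous : ∀ u, Continuous (f u)
  tangent : ∀ u χ, IsTangent χ (f u χ)
  affine_left : ∀ u (a b : MFG d n m s t) (j : ℕ), j ≤ s →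
    lblockVel (a * b) (f u (a * b)) j =
      lblockVel a (f u a) j * lblock b j + lblock a j * lblockVel b (f u b) j
        - lblock a j * lblockVel 1 (f u 1) j * lblock b j
  affine_right : ∀ u (a b : MFG d n m s t) (j : ℕ), j ≤ t →
    rblockVel (a * b) (f u (a * b)) j =
      rblockVel a (f u a) j * rblock b j + rblock a j * rblockVel b (f u b) j
        - rblock a j * rblockVel 1 (f u 1) j * rblock b j

/-- `F χ₀ = ψ(χ₀) F(id)` for a continuous (equivalently, smooth) automorphism `ψ` of `MFG`. -/
def AutCompatible (F : MFG d n m s t → MFG d n m s t) : Prop :=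
  ∃ ψ : MFG d n m s t ≃ₜ* MFG d n m s t, ∀ χ₀, F χ₀ = ψ χ₀ * F 1

/-- Under each constant input `u`, the dynamics `χ̇ = f_u(χ)` has a global flow, a
one-parameter group whose maps all are compatible with automorphisms. -/
structure IsFlowGroupAffine {U : Type*} (f : U → MFG d n m s t → MFGVel d n m s t) :
    Prop where
  continuous : ∀ u, Continuous (f u)
  flow : ∀ u, ∃ Φ : ℝ → MFG d n m s t → MFG d n m s t,
    (∀ χ₀, Φ 0 χ₀ = χ₀) ∧ (∀ σ τ χ₀, Φ (σ + τ) χ₀ = Φ σ (Φ τ χ₀)) ∧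
    (∀ τ χ₀, HasVel (fun σ => Φ σ χ₀) (f u (Φ τ χ₀)) τ) ∧
    ∀ τ, AutCompatible (Φ τ)

/-- `Φ` is the flow from time `0` of `χ̇ = f_{u_τ}(χ)` for the input signal `u`. -/
def IsFlowOf {U : Type*} (f : U → MFG d n m s t → MFGVel d n m s t) (u : ℝ → U)
    (Φ : ℝ → MFG d n m s t → MFG d n m s t) : Prop :=
  (∀ χ₀, Φ 0 χ₀ = χ₀) ∧ ∀ τ χ₀, HasVel (fun σ => Φ σ χ₀) (f (u τ) (Φ τ χ₀)) τ

end Dynamics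

/-! ### The explicit form -/

/-- `R_i R_{i+1} ⋯ R_{i+k}`. -/
def ascProd {G : Type*} [Monoid G] (R : ℕ → G) (i : ℕ) : ℕ → G
  | 0 => R i
  | k + 1 => ascProd R i k * R (i + k + 1)

/-- `R_{i+k} ⋯ R_{i+1} R_i`. -/
def descProd {G : Type*} [Monoid G] (R : ℕ → G) (i : ℕ) : ℕ → G
  | 0 => R i
  | k + 1 => R (i + k + 1) * descProd R i k

/-- Successive multiplication `R̄_{i,j}`: from `R_i` to `R_j`, ascending if `i ≤ j` and
descending if `i > j`. -/
def bar {G : Type*} [Monoid G] (R : ℕ → G) (i j : ℕ) : G :=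
  if i ≤ j then ascProd R i (j - i) else descProd R j (i - j)

/-- `Ad_R A = R A R⁻¹`. -/
def Ad {d : ℕ} (R : SO d) (A : Matrix (Fin d) (Fin d) ℝ) : Matrix (Fin d) (Fin d) ℝ :=
  (R : Matrix (Fin d) (Fin d) ℝ) * A * ((R⁻¹ : SO d) : Matrix (Fin d) (Fin d) ℝ)

/-- The free parameters. Only `lθ, lγ, lL` at `0, …, s`, `lω, lρ` at `1, …, s`, `rω, rρ, rL`
at `0, …, t` and `rθ, rγ` at `1, …, t` are ever used. The skew-symmetric matrices
`θ^×`, `ω^×` are taken as the parameters themselves. -/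
structure Params (d n m : ℕ) where
  lθ : ℕ → Skew d
  lω : ℕ → Skew d
  lγ : ℕ → Matrix (Fin d) (Fin n ⊕ Fin m) ℝ
  lρ : ℕ → Matrix (Fin d) (Fin n ⊕ Fin m) ℝ
  lL : ℕ → Matrix (Fin n ⊕ Fin m) (Fin n ⊕ Fin m) ℝ
  rθ : ℕ → Skew d
  rω : ℕ → Skew d
  rγ : ℕ → Matrix (Fin d) (Fin n ⊕ Fin m) ℝ
  rρ : ℕ → Matrix (Fin d) (Fin n ⊕ Fin m) ℝ
  rL : ℕ → Matrix (Fin n ⊕ Fin m) (Fin n ⊕ Fin m) ℝ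
  L_zero : lL 0 = -rL 0

section Form

variable {d n m s t : ℕ}

/-- Rotation components `ˡR_j`, with `ˡR₀ = R₀`. -/
def lR (χ : MFG d n m s t) (j : ℕ) : SO d := (χ.lseq j).R

/-- Rotation components `ʳR_j`, with `ʳR₀ = R₀`. -/
def rR (χ : MFG d n m s t) (j : ℕ) : SO d := (χ.rseq j).R

/-- Vector components `ˡr_j`, with `ˡr₀ = r₀`. -/
def lr (χ : MFG d n m s t) (j : ℕ) : Matrix (Fin d) (Fin n ⊕ Fin m) ℝ := (χ.lseq j).r

/-- Vector components `ʳr_j`, with `ʳr₀ = r₀`. -/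
def rr (χ : MFG d n m s t) (j : ℕ) : Matrix (Fin d) (Fin n ⊕ Fin m) ℝ := (χ.rseq j).r

/-- Right-hand side of the equation for `Ṙ₀`. (Here and below `.1` is the underlying matrix
of an element of `SO(d)` or of the skew-symmetric matrices.) -/
def coreFrame (p : Params d n m) (T : TFG d n m) : Matrix (Fin d) (Fin d) ℝ :=
  (p.lθ 0).1 * T.R.1 + T.R.1 * (p.rω 0).1

/-- Right-hand side of the equation for `ṙ₀`. -/
def coreVec (p : Params d n m) (T : TFG d n m) : Matrix (Fin d) (Fin n ⊕ Fin m) ℝ :=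
  (p.lθ 0).1 * T.r + p.lγ 0 + T.R.1 * p.rρ 0 + T.r * p.rL 0

/-- Right-hand side of the equation for `ˡṘ_j`, where `j = i + 1`. -/
def leftFrame (p : Params d n m) (χ : MFG d n m s t) (i : ℕ) : Matrix (Fin d) (Fin d) ℝ :=
  (p.lθ (i + 1)).1 * (lR χ (i + 1)).1
    + (lR χ (i + 1)).1 * (Ad (bar (lR χ) i 0) (p.lω (i + 1)).1 - (p.lθ i).1)

/-- Right-hand side of the equation for `ʳṘ_j`, where `j = i + 1`. -/
def rightFrame (p : Params d n m) (χ : MFG d n m s t) (i : ℕ) : Matrix (Fin d) (Fin d) ℝ :=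
  (Ad (bar (rR χ) 0 i)⁻¹ (p.rθ (i + 1)).1 - (p.rω i).1) * (rR χ (i + 1)).1
    + (rR χ (i + 1)).1 * (p.rω (i + 1)).1

/-- Right-hand side of the equation for `ˡṙ_j`, where `j = i + 1`. -/
def leftVec (p : Params d n m) (χ : MFG d n m s t) (i : ℕ) :
    Matrix (Fin d) (Fin n ⊕ Fin m) ℝ :=
  (∑ k ∈ Finset.range (i + 1), (bar (lR χ) (i + 1) (k + 1)).1
      * (lr χ k * (p.lL i - p.lL (i + 1)) - Ad (bar (lR χ) k 0) (p.lω (i + 1)).1 * lr χ k))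
    + p.lγ (i + 1)
    + (bar (lR χ) (i + 1) 0).1 * p.lρ (i + 1)
    + (p.lθ (i + 1)).1 * lr χ (i + 1)
    - (lR χ (i + 1)).1 * p.lγ i
    - lr χ (i + 1) * p.lL (i + 1)

/-- Right-hand side of the equation for `ʳṙ_j`, where `j = i + 1`. -/
def rightVec (p : Params d n m) (χ : MFG d n m s t) (i : ℕ) :
    Matrix (Fin d) (Fin n ⊕ Fin m) ℝ :=
  (bar (rR χ) 0 i)⁻¹.1 * (p.rθ (i + 1)).1 * rr χ 0
    + (∑ k ∈ Finset.Icc 1 i,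
        (bar (rR χ) k i)⁻¹.1 * Ad (bar (rR χ) 0 (k - 1))⁻¹ (p.rθ (i + 1)).1 * rr χ k)
    + Ad (bar (rR χ) 0 i)⁻¹ (p.rθ (i + 1)).1 * rr χ (i + 1)
    - p.rρ i
    - (∑ k ∈ Finset.range (i + 1),
        (bar (rR χ) k i)⁻¹.1 * rr χ k * (p.rL i - p.rL (i + 1)))
    + (rR χ (i + 1)).1 * p.rρ (i + 1)
    + rr χ (i + 1) * p.rL (i + 1)
    - (p.rω i).1 * rr χ (i + 1)
    + (bar (rR χ) 0 i)⁻¹.1 * p.rγ (i + 1)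

/-- The velocity prescribed by the explicit frame and vector equations. -/
def explicitField (p : Params d n m) (χ : MFG d n m s t) : MFGVel d n m s t :=
  ((coreFrame p χ.core, coreVec p χ.core),
    fun j => (leftFrame p χ j, leftVec p χ j),
    fun j => (rightFrame p χ j, rightVec p χ j))

/-- Right-hand side of the natural two-frame equation for the world-frame vectors `x₀`. -/
def naturalX (p : Params d n m) (T : TFG d n m) : Matrix (Fin d) (Fin n) ℝ :=
  (p.lθ 0).1 * T.x + (p.lγ 0).toCols₁
    + T.R.1 * ((p.rρ 0).toCols₁ + T.y * (p.rL 0).toBlocks₂₁)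
    + T.x * (p.rL 0).toBlocks₁₁

/-- Right-hand side of the natural two-frame equation for the body-frame vectors `y₀`. -/
def naturalY (p : Params d n m) (T : TFG d n m) : Matrix (Fin d) (Fin m) ℝ :=
  -((p.rω 0).1 * T.y)
    + T.R⁻¹.1 * ((p.lγ 0).toCols₂ + T.x * (p.rL 0).toBlocks₁₂)
    + (p.rρ 0).toCols₂ + T.y * (p.rL 0).toBlocks₂₂

end Form

end MultiFrame

open MultiFrame

namespace MultiFrame

/-! The chains `T₀`, `ˡT_j ⋯ T₀`, `T₀ ⋯ ʳT_j` are multiplicative and determine all factors, so they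
identify the multi-frame group, as a topological group, with a direct product of `1 + s + t` copies
of TFG (`chainEquiv`). In the coordinates `(R, r)`, TFG itself is the semi-direct product of `SO(d)`
with its action on `d × (n+m)` matrices.

In these coordinates the explicit form becomes linear: every block `X` obeys `Ẋ = ΘX + XΩ` with `Θ =
[θ, γ; 0, -L]` and `Ω = [ω, ρ; 0, L]` (`lblockVel_explicitField`, `rblockVel_explicitField`). Such a
field is visibly affine. Its flow is `e^{τΘ} X e^{τΩ} = (e^{τΘ} X e^{-τΘ}) (e^{τΘ} e^{τΩ})`, a
conjugation followed by a right translation.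

Conversely, for an affine field with component `F` in the `i`-th chain, `c(a) = F(a) aᵢ⁻¹ - F(1)` is
a cocycle: `c(ab) = c(a) + aᵢ c(b) aᵢ⁻¹`. On elements with `aᵢ = 1` it is a homomorphism to a vector
space. For `d ≥ 2` this vanishes (`TFG.hom_eq_zero`): compactness kills the rotations, and half
turns reverse the sign on vectors. So `c` depends on `aᵢ` only (`cocycle_depends`). On one copy of
TFG, averaging over `SO(d)` makes `c` a coboundary on rotations (`exists_coboundary`). After
subtracting it, the rotation part vanishes by a symmetry argument (`skew_symm_eq_zero`), and the
vector part is linear and commutes with `SO(d)`, hence is `r ↦ Ωr + rL` (`equivariant_eq`). The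
exclusions are where this breaks: for `d = 2` and several columns the commutant is larger, and for
`d = 1` TFG is a vector group, so different chains can be coupled.

A flow compatible with automorphisms satisfies `Φ(ab) = Φ(a) Φ(1)⁻¹ Φ(b)`. Differentiating this in
time, and using that each `Φ` is onto, gives the affine identity (`affine_of_flow`), so flows reduce
to the affine case. -/

/-- Square matrices with the block structure of the matrix embedding of `TFG`. -/
abbrev Blk (d n m : ℕ) := Matrix (Fin d ⊕ (Fin n ⊕ Fin m)) (Fin d ⊕ (Fin n ⊕ Fin m)) ℝ

/-! ### Topology of the rotation group -/

namespace SO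

variable {d : ℕ}

theorem coe_inv (R : SO d) : ((R⁻¹ : SO d) : Matrix (Fin d) (Fin d) ℝ) = R.1.transpose := by
  change star R.1 = _
  rw [Matrix.star_eq_conjTranspose, Matrix.conjTranspose_eq_transpose_of_trivial]

theorem coe_mul_inv (R : SO d) : R.1 * (R⁻¹ : SO d).1 = 1 := by
  rw [← Submonoid.coe_mul, mul_inv_cancel, Submonoid.coe_one]

theorem mul_inv_mul {β : Type*} (R : SO d) (M : Matrix (Fin d) β ℝ) :
    R.1 * ((R⁻¹ : SO d).1 * M) = M := by
  rw [← Matrix.mul_assoc, coe_mul_inv, Matrix.one_mul]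

theorem inv_mul_mul {β : Type*} (R : SO d) (M : Matrix (Fin d) β ℝ) :
    (R⁻¹ : SO d).1 * (R.1 * M) = M := by
  rw [← Matrix.mul_assoc, TFG.coe_inv_mul, Matrix.one_mul]

/-- Membership in `SO(d)` from orthogonality and determinant. -/
def ofMatrix (M : Matrix (Fin d) (Fin d) ℝ) (h : M * M.transpose = 1) (hdet : M.det = 1) :
    SO d :=
  ⟨M, Matrix.mem_specialOrthogonalGroup_iff.2 ⟨(Matrix.mem_orthogonalGroup_iff _ _).2 h, hdet⟩⟩

theorem isClosed_coe : IsClosed ((Matrix.specialOrthogonalGroup (Fin d) ℝ :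
    Submonoid (Matrix (Fin d) (Fin d) ℝ)) : Set (Matrix (Fin d) (Fin d) ℝ)) := by
  have : ((Matrix.specialOrthogonalGroup (Fin d) ℝ :
      Submonoid (Matrix (Fin d) (Fin d) ℝ)) : Set (Matrix (Fin d) (Fin d) ℝ))
      = {M | M * M.transpose = 1} ∩ {M | M.det = 1} := by
    ext M
    simp [Matrix.mem_specialOrthogonalGroup_iff, Matrix.mem_orthogonalGroup_iff]
  rw [this]
  refine IsClosed.inter (isClosed_eq ?_ continuous_const) (isClosed_eq ?_ continuous_const)
  · exact continuous_id.matrix_mul continuous_id.matrix_transpose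
  · exact continuous_id.matrix_det

/-- Closed, with all entries in `[-1, 1]`. Compactness is what permits averaging cocycles over
rotations. -/
instance : CompactSpace (SO d) := by
  refine isCompact_iff_compactSpace.1 (IsCompact.of_isClosed_subset
    (isCompact_univ_pi fun _ : Fin d => isCompact_univ_pi fun _ : Fin d =>
      isCompact_Icc (a := (-1 : ℝ)) (b := 1)) isClosed_coe ?_)
  intro M hM i _ j _
  have := entry_norm_bound_of_unitary (𝕜 := ℝ)
    (Matrix.mem_specialOrthogonalGroup_iff.1 hM).1 i j
  rwa [Real.norm_eq_abs, abs_le] at this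

instance : IsTopologicalGroup (SO d) where
  continuous_mul := Continuous.subtype_mk
    ((continuous_subtype_val.comp continuous_fst).matrix_mul
      (continuous_subtype_val.comp continuous_snd)) _
  continuous_inv := Continuous.subtype_mk (continuous_subtype_val.matrix_conjTranspose) _

end SO

/-! ### `TFG` as a semi-direct product of `SO(d)` and the vector components -/

namespace TFG

variable {d n m : ℕ}

@[simp] theorem mul_R (a b : TFG d n m) : (a * b).R = a.R * b.R := rfl
@[simp] theorem one_R : (1 : TFG d n m).R = 1 := rfl
@[simp] theorem inv_R (a : TFG d n m) : a⁻¹.R = a.R⁻¹ := rfl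

/-- Moving the body-frame vectors to the world frame by `R` cancels the twist `R'⁻¹` of the product,
so both kinds of vectors obey one rule. -/
theorem r_mul (a b : TFG d n m) : (a * b).r = a.r + a.R.1 * b.r := by
  ext i (j | j)
  · simp [r, mul_def, Matrix.mul_fromCols]
  · simp only [r, mul_def, Matrix.mul_fromCols, Matrix.fromCols_apply_inr, Matrix.add_apply,
      Submonoid.coe_mul, Matrix.mul_assoc, Matrix.mul_add, SO.mul_inv_mul]

@[simp] theorem r_one : (1 : TFG d n m).r = 0 := by
  ext i (j | j) <;> simp [r, one_def]

theorem r_inv (a : TFG d n m) : a⁻¹.r = -((a.R⁻¹ : SO d).1 * a.r) := by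
  have h := r_mul a⁻¹ a
  rw [inv_mul_cancel, r_one, inv_R] at h
  exact eq_neg_of_add_eq_zero_left h.symm

theorem ext_r {a b : TFG d n m} (hR : a.R = b.R) (hr : a.r = b.r) : a = b := by
  have h := Matrix.fromCols_inj hr
  obtain ⟨h1, h2⟩ := h
  refine TFG.ext hR h1 ?_
  rw [hR] at h2
  rw [← SO.inv_mul_mul b.R a.y, h2, SO.inv_mul_mul]

/-- The element of `TFG` with given rotation and vector component `r`. -/
def ofRr (R : SO d) (r : Matrix (Fin d) (Fin n ⊕ Fin m) ℝ) : TFG d n m where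
  R := R
  x := r.toCols₁
  y := (R⁻¹ : SO d).1 * r.toCols₂

@[simp] theorem ofRr_R (R : SO d) (r : Matrix (Fin d) (Fin n ⊕ Fin m) ℝ) :
    (ofRr R r).R = R := rfl

@[simp] theorem ofRr_r (R : SO d) (r : Matrix (Fin d) (Fin n ⊕ Fin m) ℝ) :
    (ofRr R r).r = r := by
  simp only [TFG.r, ofRr, SO.mul_inv_mul, Matrix.fromCols_toCols]

theorem ofRr_mul (R S : SO d) (r q : Matrix (Fin d) (Fin n ⊕ Fin m) ℝ) :
    ofRr R r * ofRr S q = ofRr (R * S) (r + R.1 * q) :=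
  ext_r rfl (by simp [r_mul])

theorem ofRr_self (T : TFG d n m) : ofRr T.R T.r = T := ext_r rfl (by simp)

theorem continuous_components : Continuous fun T : TFG d n m => (T.R, T.x, T.y) :=
  continuous_induced_dom

theorem continuous_R : Continuous (R : TFG d n m → SO d) :=
  continuous_fst.comp continuous_components

theorem continuous_x : Continuous (x : TFG d n m → _) :=
  continuous_fst.comp (continuous_snd.comp continuous_components)

theorem continuous_y : Continuous (y : TFG d n m → _) :=
  continuous_snd.comp (continuous_snd.comp continuous_components)

theorem continuous_mk {X : Type*} [TopologicalSpace X] {R : X → SO d}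
    {x : X → Matrix (Fin d) (Fin n) ℝ} {y : X → Matrix (Fin d) (Fin m) ℝ}
    (hR : Continuous R) (hx : Continuous x) (hy : Continuous y) :
    Continuous (fun i => (⟨R i, x i, y i⟩ : TFG d n m)) :=
  continuous_induced_rng.2 (hR.prodMk (hx.prodMk hy))

theorem continuous_r : Continuous (r : TFG d n m → _) := by
  refine continuous_matrix fun i j => ?_
  rcases j with j | j
  · exact continuous_x.matrix_elem i j
  · exact ((continuous_subtype_val.comp continuous_R).matrix_mul continuous_y).matrix_elem i j

theorem continuous_ofRr {X : Type*} [TopologicalSpace X] {R : X → SO d}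
    {r : X → Matrix (Fin d) (Fin n ⊕ Fin m) ℝ} (hR : Continuous R) (hr : Continuous r) :
    Continuous (fun i => ofRr (R i) (r i)) :=
  continuous_mk hR (continuous_matrix fun i j => hr.matrix_elem i (Sum.inl j))
    ((continuous_subtype_val.comp hR.inv).matrix_mul
      (continuous_matrix fun i j => hr.matrix_elem i (Sum.inr j)))

instance : IsTopologicalGroup (TFG d n m) where
  continuous_mul := by
    have h : (fun p : TFG d n m × TFG d n m => p.1 * p.2) = fun p =>
        ofRr (p.1.R * p.2.R) (p.1.r + p.1.R.1 * p.2.r) := by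
      funext p
      exact ext_r rfl (by simp [r_mul])
    rw [h]
    have h1 := continuous_R.comp (continuous_fst (X := TFG d n m) (Y := TFG d n m))
    have h2 := continuous_R.comp (continuous_snd (X := TFG d n m) (Y := TFG d n m))
    exact continuous_ofRr (h1.mul h2) ((continuous_r.comp continuous_fst).add
      ((continuous_subtype_val.comp h1).matrix_mul (continuous_r.comp continuous_snd)))
  continuous_inv := by
    have h : (fun p : TFG d n m => p⁻¹) = fun p =>
        ofRr p.R⁻¹ (-((p.R⁻¹ : SO d).1 * p.r)) := by
      funext p
      exact ext_r rfl (by simp [r_inv])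
    rw [h]
    exact continuous_ofRr continuous_R.inv
      ((continuous_subtype_val.comp continuous_R.inv).matrix_mul continuous_r).neg

theorem toMat_mul (a b : TFG d n m) : (a * b).toMat = a.toMat * b.toMat := by
  simp [toMat, Matrix.fromBlocks_multiply, r_mul, add_comm]

@[simp] theorem toMat_one : (1 : TFG d n m).toMat = 1 := by
  simp [toMat]

theorem toMat_mul_inv (a : TFG d n m) : a.toMat * a⁻¹.toMat = 1 := by
  rw [← toMat_mul, mul_inv_cancel, toMat_one]

theorem toMat_inv_mul (a : TFG d n m) : a⁻¹.toMat * a.toMat = 1 := by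
  rw [← toMat_mul, inv_mul_cancel, toMat_one]

theorem toMat_injective : Function.Injective (toMat : TFG d n m → Blk d n m) := by
  intro a b h
  obtain ⟨h1, h2, -, -⟩ := Matrix.fromBlocks_inj.1 h
  exact ext_r (Subtype.ext h1) h2

theorem continuous_toMat : Continuous (toMat : TFG d n m → Blk d n m) :=
  (continuous_subtype_val.comp continuous_R).matrix_fromBlocks continuous_r continuous_const
    continuous_const

end TFG

/-! ### Chains identify the extension with a direct product -/

namespace TypeII

variable {G : Type*} {s t : ℕ}

section Topology

variable [TopologicalSpace G]

theorem continuous_components :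
    Continuous fun χ : TypeII G s t => (χ.core, χ.left, χ.right) :=
  continuous_induced_dom

theorem continuous_core : Continuous (core : TypeII G s t → G) :=
  continuous_fst.comp continuous_components

theorem continuous_left : Continuous (left : TypeII G s t → _) :=
  continuous_fst.comp (continuous_snd.comp continuous_components)

theorem continuous_right : Continuous (right : TypeII G s t → _) :=
  continuous_snd.comp (continuous_snd.comp continuous_components)

end Topology

variable [Group G]

/-- Index set of the chains. -/
abbrev Idx (s t : ℕ) := Option (Fin s ⊕ Fin t)

/-- The index of the chain `ˡg_j ⋯ ˡg₁ g₀` (junk for `j > s`). -/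
def lidx : ℕ → Idx s t
  | 0 => none
  | i + 1 => if h : i < s then some (Sum.inl ⟨i, h⟩) else none

/-- The index of the chain `g₀ ʳg₁ ⋯ ʳg_j` (junk for `j > t`). -/
def ridx : ℕ → Idx s t
  | 0 => none
  | i + 1 => if h : i < t then some (Sum.inr ⟨i, h⟩) else none

/-- All the chains of an element. -/
def chain (χ : TypeII G s t) : Idx s t → G
  | none => χ.core
  | some (Sum.inl j) => χ.lchain (j + 1)
  | some (Sum.inr j) => χ.rchain (j + 1)

theorem chain_lidx (χ : TypeII G s t) {j : ℕ} (hj : j ≤ s) : χ.chain (lidx j) = χ.lchain j := by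
  cases j with
  | zero => rfl
  | succ i => simp only [lidx, Nat.lt_of_succ_le hj, dite_true, chain]

theorem chain_ridx (χ : TypeII G s t) {j : ℕ} (hj : j ≤ t) : χ.chain (ridx j) = χ.rchain j := by
  cases j with
  | zero => rfl
  | succ i => simp only [ridx, Nat.lt_of_succ_le hj, dite_true, chain]

/-- The element with prescribed chains. -/
def ofChain (g : Idx s t → G) : TypeII G s t where
  core := g none
  left := fun j => g (some (Sum.inl j)) * (g (lidx j))⁻¹
  right := fun j => (g (ridx j))⁻¹ * g (some (Sum.inr j))

theorem lchain_ofChain (g : Idx s t → G) {j : ℕ} (hj : j ≤ s) :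
    (ofChain g).lchain j = g (lidx j) := by
  induction j with
  | zero => rfl
  | succ i ih =>
    have hi : i < s := hj
    rw [lchain, ih hi.le]
    simp [lseq, hi, ofChain, lidx]

theorem rchain_ofChain (g : Idx s t → G) {j : ℕ} (hj : j ≤ t) :
    (ofChain g).rchain j = g (ridx j) := by
  induction j with
  | zero => rfl
  | succ i ih =>
    have hi : i < t := hj
    rw [rchain, ih hi.le]
    simp [rseq, hi, ofChain, ridx]

theorem chain_ofChain (g : Idx s t → G) : (ofChain g).chain = g := by
  funext i
  rcases i with _ | j | j
  · rfl
  · simp [chain, lchain_ofChain g (Nat.succ_le_of_lt j.isLt), lidx]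
  · simp [chain, rchain_ofChain g (Nat.succ_le_of_lt j.isLt), ridx]

theorem lchain_of_le (χ : TypeII G s t) {j : ℕ} (hj : s ≤ j) : χ.lchain j = χ.lchain s := by
  induction j, hj using Nat.le_induction with
  | base => rfl
  | succ i hi ih => rw [lchain, ih]; simp [lseq, Nat.not_lt.2 hi]

theorem rchain_of_le (χ : TypeII G s t) {j : ℕ} (hj : t ≤ j) : χ.rchain j = χ.rchain t := by
  induction j, hj using Nat.le_induction with
  | base => rfl
  | succ i hi ih => rw [rchain, ih]; simp [rseq, Nat.not_lt.2 hi]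

/-- `ext_chain` asks for chains of every length. Beyond `s` and `t` they are constant because the
factors are continued by `1`. -/
theorem chain_injective : Function.Injective (chain : TypeII G s t → Idx s t → G) := by
  intro a b h
  have hl : ∀ j, j ≤ s → a.lchain j = b.lchain j := fun j hj => by
    rw [← chain_lidx a hj, ← chain_lidx b hj, h]
  have hr : ∀ j, j ≤ t → a.rchain j = b.rchain j := fun j hj => by
    rw [← chain_ridx a hj, ← chain_ridx b hj, h]
  refine ext_chain (fun j => ?_) (fun j => ?_)
  · rcases le_total j s with hj | hj
    · exact hl j hj
    · rw [lchain_of_le a hj, lchain_of_le b hj, hl s le_rfl]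
  · rcases le_total j t with hj | hj
    · exact hr j hj
    · rw [rchain_of_le a hj, rchain_of_le b hj, hr t le_rfl]

variable [TopologicalSpace G]

theorem continuous_lseq (j : ℕ) : Continuous fun χ : TypeII G s t => χ.lseq j := by
  cases j with
  | zero => exact continuous_core
  | succ i =>
    by_cases h : i < s
    · simpa [lseq, h] using (continuous_apply (⟨i, h⟩ : Fin _)).comp' continuous_left
    · simpa [lseq, h] using continuous_const

theorem continuous_rseq (j : ℕ) : Continuous fun χ : TypeII G s t => χ.rseq j := by
  cases j with
  | zero => exact continuous_core
  | succ i =>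
    by_cases h : i < t
    · simpa [rseq, h] using (continuous_apply (⟨i, h⟩ : Fin _)).comp' continuous_right
    · simpa [rseq, h] using continuous_const

variable [IsTopologicalGroup G]

theorem continuous_lchain (j : ℕ) : Continuous fun χ : TypeII G s t => χ.lchain j := by
  induction j with
  | zero => exact continuous_core
  | succ i ih => exact (continuous_lseq (i + 1)).mul ih

theorem continuous_rchain (j : ℕ) : Continuous fun χ : TypeII G s t => χ.rchain j := by
  induction j with
  | zero => exact continuous_core
  | succ i ih => exact ih.mul (continuous_rseq (i + 1))

/-- The chains identify the extension with a direct product of copies of `G`. -/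
def chainEquiv (G : Type*) [Group G] [TopologicalSpace G] [IsTopologicalGroup G] (s t : ℕ) :
    TypeII G s t ≃ₜ* (Idx s t → G) where
  toFun := chain
  invFun := ofChain
  left_inv χ := chain_injective (chain_ofChain _)
  right_inv := chain_ofChain
  map_mul' a b := by
    funext i
    rcases i with _ | j | j
    · rfl
    · exact lchain_mul a b _
    · exact rchain_mul a b _
  continuous_toFun := by
    refine continuous_pi fun i => ?_
    rcases i with _ | j | j
    · exact continuous_core
    · exact continuous_lchain _
    · exact continuous_rchain _
  continuous_invFun := by
    refine continuous_induced_rng.2 ((continuous_apply _).prodMk (Continuous.prodMk ?_ ?_))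
    · exact continuous_pi fun j => (continuous_apply _).mul (continuous_apply _).inv
    · exact continuous_pi fun j => (continuous_apply _).inv.mul (continuous_apply _)

@[simp] theorem chain_chainEquiv_symm (g : Idx s t → G) :
    ((chainEquiv G s t).symm g).chain = g := chain_ofChain g

end TypeII

end MultiFrame

namespace MultiFrame

open TypeII

/-! ### Successive multiplication -/

section Bar

variable {G : Type*} [Group G] (R : ℕ → G)

theorem bar_of_le {i j : ℕ} (h : i ≤ j) : bar R i j = ascProd R i (j - i) := if_pos h

theorem bar_of_ge {i j : ℕ} (h : j ≤ i) : bar R i j = descProd R j (i - j) := by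
  rcases h.eq_or_lt with rfl | h
  · simp [bar, ascProd, descProd]
  · exact if_neg (by omega)

@[simp] theorem bar_self (i : ℕ) : bar R i i = R i := by simp [bar, ascProd]

theorem bar_succ_left {i j : ℕ} (h : j ≤ i) : bar R (i + 1) j = R (i + 1) * bar R i j := by
  rw [bar_of_ge R h, bar_of_ge R (by omega : j ≤ i + 1), Nat.succ_sub h, descProd,
    Nat.add_sub_cancel' h]

theorem bar_succ_right {i j : ℕ} (h : i ≤ j) : bar R i (j + 1) = bar R i j * R (j + 1) := by
  rw [bar_of_le R h, bar_of_le R (by omega : i ≤ j + 1), Nat.succ_sub h, ascProd,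
    Nat.add_sub_cancel' h]

theorem bar_mul_bar_desc {i k : ℕ} (h : k ≤ i) :
    bar R (i + 1) (k + 1) * bar R k 0 = bar R (i + 1) 0 := by
  induction i, h using Nat.le_induction with
  | base => rw [bar_self, bar_succ_left R (Nat.zero_le k)]
  | succ i hi ih =>
    rw [bar_succ_left R (by omega : k + 1 ≤ i + 1), mul_assoc, ih,
      ← bar_succ_left R (Nat.zero_le _)]

theorem bar_mul_bar_asc {i k : ℕ} (h : k + 1 ≤ i) :
    bar R 0 k * bar R (k + 1) i = bar R 0 i := by
  induction i, h using Nat.le_induction with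
  | base => rw [bar_self, bar_succ_right R (Nat.zero_le k)]
  | succ i hi ih =>
    rw [bar_succ_right R hi, ← mul_assoc, ih, ← bar_succ_right R (Nat.zero_le _)]

end Bar

variable {d n m s t : ℕ}

/-! ### Rotation and vector components of the chains -/

section Chains

variable (χ : MFG d n m s t)

theorem lchain_R (j : ℕ) : (χ.lchain j).R = bar (lR χ) j 0 := by
  induction j with
  | zero => rw [bar_self]; rfl
  | succ i ih => rw [lchain, TFG.mul_R, ih, bar_succ_left _ (Nat.zero_le i)]; rfl

theorem rchain_R (j : ℕ) : (χ.rchain j).R = bar (rR χ) 0 j := by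
  induction j with
  | zero => rw [bar_self]; rfl
  | succ i ih => rw [rchain, TFG.mul_R, ih, bar_succ_right _ (Nat.zero_le i)]; rfl

theorem lchain_r_succ (i : ℕ) :
    (χ.lchain (i + 1)).r = lr χ (i + 1) + (lR χ (i + 1)).1 * (χ.lchain i).r :=
  TFG.r_mul _ _

theorem rchain_r_succ (i : ℕ) :
    (χ.rchain (i + 1)).r = (χ.rchain i).r + (χ.rchain i).R.1 * rr χ (i + 1) :=
  TFG.r_mul _ _

/-- Unrolled recursion `lchain_r_succ`. It collapses the sums of the explicit form into data of a
single chain. -/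
theorem sum_bar_lr (i : ℕ) :
    ∑ k ∈ Finset.range (i + 1), (bar (lR χ) (i + 1) (k + 1)).1 * lr χ k
      = (lR χ (i + 1)).1 * (χ.lchain i).r := by
  induction i with
  | zero => simp [lchain, lr, lseq]
  | succ i ih =>
    rw [Finset.sum_range_succ, bar_self, lchain_r_succ, Matrix.mul_add, ← ih, Matrix.mul_sum,
      add_comm]
    congr 1
    refine Finset.sum_congr rfl fun k hk => ?_
    rw [bar_succ_left _ (by have := Finset.mem_range.1 hk; omega), Submonoid.coe_mul,
      Matrix.mul_assoc]

/-- The right-hand counterpart: the vector component of the chain seen in its own body frame. -/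
theorem sum_bar_rr (i : ℕ) :
    ∑ k ∈ Finset.range (i + 1), (bar (rR χ) k i)⁻¹.1 * rr χ k
      = (χ.rchain i).R⁻¹.1 * (χ.rchain i).r := by
  induction i with
  | zero => simp [rchain, rr, rR, rseq]
  | succ i ih =>
    have h : (χ.rchain (i + 1)).R = (χ.rchain i).R * rR χ (i + 1) := rfl
    rw [Finset.sum_range_succ, bar_self, rchain_r_succ, h, mul_inv_rev, Submonoid.coe_mul,
      Matrix.mul_assoc, Matrix.mul_add, SO.inv_mul_mul, ← ih, Matrix.mul_add, Matrix.mul_sum]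
    congr 1
    refine Finset.sum_congr rfl fun k hk => ?_
    rw [bar_succ_right _ (by have := Finset.mem_range.1 hk; omega), mul_inv_rev,
      Submonoid.coe_mul, Matrix.mul_assoc]

end Chains

/-- If `B P = Q` then `B Ad_P A = Ad_Q A B`. -/
theorem mul_Ad {B P Q : SO d} (h : B * P = Q) (A : Matrix (Fin d) (Fin d) ℝ) :
    B.1 * Ad P A = Ad Q A * B.1 := by
  have hP : P⁻¹ = Q⁻¹ * B := by rw [← h]; group
  simp only [Ad, hP, ← h, Submonoid.coe_mul, Matrix.mul_assoc]

/-! ### The vector equations without sums -/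

section ClosedForm

variable (p : Params d n m) (χ : MFG d n m s t) (i : ℕ)

/-- Each conjugation by `R̄_{k,0}` passes through `R̄_{i+1,k+1}` and becomes conjugation by the full
chain, which no longer depends on `k`. Then `sum_bar_lr` applies. -/
theorem leftVec_eq : leftVec p χ i =
    (lR χ (i + 1)).1 * (χ.lchain i).r * (p.lL i - p.lL (i + 1))
    - Ad (χ.lchain (i + 1)).R (p.lω (i + 1)).1 * ((lR χ (i + 1)).1 * (χ.lchain i).r)
    + p.lγ (i + 1) + (χ.lchain (i + 1)).R.1 * p.lρ (i + 1)
    + (p.lθ (i + 1)).1 * lr χ (i + 1) - (lR χ (i + 1)).1 * p.lγ i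
    - lr χ (i + 1) * p.lL (i + 1) := by
  unfold leftVec
  rw [lchain_R, ← sum_bar_lr, Matrix.sum_mul, Matrix.mul_sum, ← Finset.sum_sub_distrib]
  congr 5
  refine Finset.sum_congr rfl fun k hk => ?_
  rw [Matrix.mul_sub, ← Matrix.mul_assoc, ← Matrix.mul_assoc, ← Matrix.mul_assoc,
    mul_Ad (bar_mul_bar_desc _ (by have := Finset.mem_range.1 hk; omega))]

theorem rightVec_eq : rightVec p χ i =
    Ad (χ.rchain i).R⁻¹ (p.rθ (i + 1)).1 * ((χ.rchain i).R⁻¹.1 * (χ.rchain i).r)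
    + Ad (χ.rchain i).R⁻¹ (p.rθ (i + 1)).1 * rr χ (i + 1) - p.rρ i
    - (χ.rchain i).R⁻¹.1 * (χ.rchain i).r * (p.rL i - p.rL (i + 1))
    + (rR χ (i + 1)).1 * p.rρ (i + 1) + rr χ (i + 1) * p.rL (i + 1)
    - (p.rω i).1 * rr χ (i + 1) + (χ.rchain i).R⁻¹.1 * p.rγ (i + 1) := by
  unfold rightVec
  rw [← sum_bar_rr, Matrix.sum_mul, rchain_R]
  congr 7
  -- The term `k = 0` stands apart in the equation, since its conjugating product would be empty. It
  -- is matched below with `P = 1`.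
  rw [Finset.range_eq_Ico, Finset.sum_eq_sum_Ico_succ_bot (Nat.succ_pos i), Matrix.mul_add,
    Matrix.mul_sum]
  congr 1
  · rw [← Matrix.mul_assoc]
    congr 1
    have := mul_Ad (B := (bar (rR χ) 0 i)⁻¹) (P := 1) (mul_one _) (p.rθ (i + 1)).1
    rw [← this]
    simp [Ad]
  · refine Finset.sum_congr rfl fun k hk => ?_
    obtain ⟨h1, h2⟩ := Finset.mem_Icc.1 hk
    obtain ⟨k, rfl⟩ : ∃ l, k = l + 1 := ⟨k - 1, by omega⟩
    rw [← Matrix.mul_assoc, Nat.add_sub_cancel]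
    congr 1
    refine mul_Ad ?_ _
    rw [← mul_inv_rev, bar_mul_bar_asc _ h2]

end ClosedForm

/-! ### The explicit form in the chains -/

/-- `[θ, γ; 0, L]`. -/
def blk (θ : Matrix (Fin d) (Fin d) ℝ) (γ : Matrix (Fin d) (Fin n ⊕ Fin m) ℝ)
    (L : Matrix (Fin n ⊕ Fin m) (Fin n ⊕ Fin m) ℝ) : Blk d n m := Matrix.fromBlocks θ γ 0 L

theorem blk_mul (θ θ' : Matrix (Fin d) (Fin d) ℝ) (γ γ' : Matrix (Fin d) (Fin n ⊕ Fin m) ℝ)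
    (L L' : Matrix (Fin n ⊕ Fin m) (Fin n ⊕ Fin m) ℝ) :
    blk θ γ L * blk θ' γ' L' = blk (θ * θ') (θ * γ' + γ * L') (L * L') := by
  simp [blk, Matrix.fromBlocks_multiply]

theorem blk_add (θ θ' : Matrix (Fin d) (Fin d) ℝ) (γ γ' : Matrix (Fin d) (Fin n ⊕ Fin m) ℝ)
    (L L' : Matrix (Fin n ⊕ Fin m) (Fin n ⊕ Fin m) ℝ) :
    blk θ γ L + blk θ' γ' L' = blk (θ + θ') (γ + γ') (L + L') := by
  simp [blk, Matrix.fromBlocks_add]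

theorem blk_sub (θ θ' : Matrix (Fin d) (Fin d) ℝ) (γ γ' : Matrix (Fin d) (Fin n ⊕ Fin m) ℝ)
    (L L' : Matrix (Fin n ⊕ Fin m) (Fin n ⊕ Fin m) ℝ) :
    blk θ γ L - blk θ' γ' L' = blk (θ - θ') (γ - γ') (L - L') := by
  simp [blk, sub_eq_add_neg, Matrix.fromBlocks_neg, Matrix.fromBlocks_add]

theorem blk_inj {θ θ' : Matrix (Fin d) (Fin d) ℝ} {γ γ' : Matrix (Fin d) (Fin n ⊕ Fin m) ℝ}
    {L L' : Matrix (Fin n ⊕ Fin m) (Fin n ⊕ Fin m) ℝ} :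
    blk θ γ L = blk θ' γ' L' ↔ θ = θ' ∧ γ = γ' ∧ L = L' := by
  simp [blk, Matrix.fromBlocks_inj]

theorem velMat_eq (V : TFGVel d n m) : velMat V = blk V.1 V.2 0 := rfl

theorem toMat_eq (T : TFG d n m) : T.toMat = blk T.R.1 T.r 1 := rfl

theorem velMat_injective : Function.Injective (velMat : TFGVel d n m → Blk d n m) := by
  intro V W h
  obtain ⟨h1, h2, -⟩ := blk_inj.1 h
  exact Prod.ext h1 h2

/-- World-frame parameters of the left chains. -/
def Params.lΘ (p : Params d n m) (j : ℕ) : Blk d n m := blk (p.lθ j).1 (p.lγ j) (p.lL j)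

/-- Increments of the body-frame parameters along the left chains. -/
def Params.lW (p : Params d n m) (i : ℕ) : Blk d n m :=
  blk (p.lω (i + 1)).1 (p.lρ (i + 1)) (p.lL i - p.lL (i + 1))

/-- Body-frame parameters of the right chains. -/
def Params.rΩ (p : Params d n m) (j : ℕ) : Blk d n m := blk (p.rω j).1 (p.rρ j) (p.rL j)

/-- Increments of the world-frame parameters along the right chains. -/
def Params.rZ (p : Params d n m) (i : ℕ) : Blk d n m :=
  blk (p.rθ (i + 1)).1 (p.rγ (i + 1)) (p.rL i - p.rL (i + 1))

/-- Body-frame parameters of the left chains. -/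
def Params.lΩ (p : Params d n m) : ℕ → Blk d n m
  | 0 => p.rΩ 0
  | i + 1 => lΩ p i + p.lW i

/-- World-frame parameters of the right chains. -/
def Params.rΘ (p : Params d n m) : ℕ → Blk d n m
  | 0 => p.lΘ 0
  | i + 1 => rΘ p i + p.rZ i

/-- In the product rule for the next chain, the subtracted term cancels the `Θ`-part of the velocity
of the previous chain. Its `Ω`-part is carried along and receives the increment `lW i`. -/
theorem left_vel_mul_lblock (p : Params d n m) (χ : MFG d n m s t) (i : ℕ) :
    velMat (leftFrame p χ i, leftVec p χ i) * lblock χ i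
      = p.lΘ (i + 1) * lblock χ (i + 1) + lblock χ (i + 1) * p.lW i
        - (χ.lseq (i + 1)).toMat * (p.lΘ i * lblock χ i) := by
  have hR : (χ.lchain (i + 1)).R = lR χ (i + 1) * (χ.lchain i).R := rfl
  have hA : Ad (χ.lchain (i + 1)).R (p.lω (i + 1)).1 * (lR χ (i + 1)).1
      = (lR χ (i + 1)).1 * Ad (χ.lchain i).R (p.lω (i + 1)).1 := (mul_Ad hR.symm _).symm
  have hB : Ad (χ.lchain i).R (p.lω (i + 1)).1 * (χ.lchain i).R.1
      = (χ.lchain i).R.1 * (p.lω (i + 1)).1 := by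
    rw [Ad, Matrix.mul_assoc, TFG.coe_inv_mul, Matrix.mul_one]
  have hT : (χ.lseq (i + 1)).toMat = blk (lR χ (i + 1)).1 (lr χ (i + 1)) 1 := rfl
  rw [leftVec_eq, leftFrame, ← lchain_R, hT]
  simp only [lblock, toMat_eq, velMat_eq, Params.lΘ, Params.lW, blk_mul, blk_add, blk_sub]
  rw [blk_inj]
  refine ⟨?_, ?_, by simp⟩
  · simp only [hR, Submonoid.coe_mul, Matrix.add_mul, Matrix.mul_sub, Matrix.sub_mul,
      Matrix.mul_assoc, hB]
    abel
  · rw [← Matrix.mul_assoc (Ad _ _), hA, lchain_r_succ]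
    simp only [Matrix.add_mul, Matrix.mul_sub, Matrix.sub_mul, Matrix.mul_add,
      Matrix.mul_assoc, Matrix.mul_one]
    abel

/-- Mirror image: here the `Ω`-part of the previous chain is cancelled and the `Θ`-part accumulates
`rZ i`. -/
theorem rblock_mul_right_vel (p : Params d n m) (χ : MFG d n m s t) (i : ℕ) :
    rblock χ i * velMat (rightFrame p χ i, rightVec p χ i)
      = p.rZ i * rblock χ (i + 1) + rblock χ (i + 1) * p.rΩ (i + 1)
        - rblock χ i * p.rΩ i * (χ.rseq (i + 1)).toMat := by
  have hR : (χ.rchain (i + 1)).R = (χ.rchain i).R * rR χ (i + 1) := rfl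
  have hB : (χ.rchain i).R.1 * Ad (χ.rchain i).R⁻¹ (p.rθ (i + 1)).1
      = (p.rθ (i + 1)).1 * (χ.rchain i).R.1 := by
    rw [Ad, inv_inv, Matrix.mul_assoc, SO.mul_inv_mul]
  have hT : (χ.rseq (i + 1)).toMat = blk (rR χ (i + 1)).1 (rr χ (i + 1)) 1 := rfl
  rw [rightVec_eq, rightFrame, ← rchain_R, hT]
  simp only [rblock, toMat_eq, velMat_eq, Params.rΩ, Params.rZ, blk_mul, blk_add, blk_sub]
  rw [blk_inj]
  refine ⟨?_, ?_, by simp⟩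
  · rw [Matrix.mul_add, ← Matrix.mul_assoc (χ.rchain i).R.1, Matrix.mul_sub, hB, hR]
    simp only [Submonoid.coe_mul, Matrix.sub_mul, Matrix.mul_assoc]
    abel
  · rw [rchain_r_succ]
    simp only [Matrix.mul_add, Matrix.mul_sub, ← Matrix.mul_assoc, hB]
    simp only [hR, Submonoid.coe_mul, Matrix.add_mul, Matrix.mul_assoc,
      Matrix.mul_one, SO.mul_inv_mul, Matrix.mul_zero]
    abel

theorem coreVel_eq (p : Params d n m) (T : TFG d n m) :
    velMat (coreFrame p T, coreVec p T) = p.lΘ 0 * T.toMat + T.toMat * p.rΩ 0 := by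
  simp only [toMat_eq, velMat_eq, Params.lΘ, Params.rΩ, blk_mul, blk_add]
  rw [blk_inj]
  -- A velocity has zero lower right block; this is exactly the constraint `lL 0 = -rL 0`.
  refine ⟨rfl, ?_, by simp [p.L_zero]⟩
  simp only [coreVec, Matrix.mul_one]
  abel

theorem lblockVel_explicitField (p : Params d n m) (χ : MFG d n m s t) {j : ℕ} (hj : j ≤ s) :
    lblockVel χ (explicitField p χ) j = p.lΘ j * lblock χ j + lblock χ j * p.lΩ j := by
  induction j with
  | zero => exact coreVel_eq p χ.core
  | succ i ih =>
    have hi : i < s := hj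
    have hv : lvel (explicitField p χ) (i + 1) = (leftFrame p χ i, leftVec p χ i) := by
      simp [lvel, hi, explicitField]
    have hc : lblock χ (i + 1) = (χ.lseq (i + 1)).toMat * lblock χ i := TFG.toMat_mul _ _
    rw [lblockVel, hv, left_vel_mul_lblock, ih hi.le, Params.lΩ, hc]
    simp only [mul_add, mul_assoc]
    abel

theorem rblockVel_explicitField (p : Params d n m) (χ : MFG d n m s t) {j : ℕ} (hj : j ≤ t) :
    rblockVel χ (explicitField p χ) j = p.rΘ j * rblock χ j + rblock χ j * p.rΩ j := by
  induction j with
  | zero => exact coreVel_eq p χ.core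
  | succ i ih =>
    have hi : i < t := hj
    have hv : rvel (explicitField p χ) (i + 1) = (rightFrame p χ i, rightVec p χ i) := by
      simp [rvel, hi, explicitField]
    have hc : rblock χ (i + 1) = rblock χ i * (χ.rseq (i + 1)).toMat := TFG.toMat_mul _ _
    rw [rblockVel, hv, rblock_mul_right_vel, ih hi.le, Params.rΘ, hc]
    simp only [add_mul, mul_assoc]
    abel

/-- A velocity is determined by the velocities of the diagonal blocks. -/
theorem vel_ext {χ : MFG d n m s t} {V W : MFGVel d n m s t}
    (hl : ∀ j ≤ s, lblockVel χ V j = lblockVel χ W j)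
    (hr : ∀ j ≤ t, rblockVel χ V j = rblockVel χ W j) : V = W := by
  refine Prod.ext (velMat_injective (hl 0 (Nat.zero_le _))) (Prod.ext ?_ ?_)
  · funext j
    have h := hl (j + 1) j.isLt
    rw [lblockVel, lblockVel, hl j j.isLt.le] at h
    have h' := congrArg (· * (χ.lchain j)⁻¹.toMat) (add_right_cancel h)
    simp only [lblock, mul_assoc, TFG.toMat_mul_inv, mul_one] at h'
    simpa [lvel] using velMat_injective h'
  · funext j
    have h := hr (j + 1) j.isLt
    rw [rblockVel, rblockVel, hr j j.isLt.le] at h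
    have h' := congrArg ((χ.rchain j)⁻¹.toMat * ·) (add_left_cancel h)
    simp only [rblock, ← mul_assoc, TFG.toMat_inv_mul, one_mul] at h'
    simpa [rvel] using velMat_injective h'

end MultiFrame

namespace MultiFrame

open MeasureTheory TypeII

/-! ### Cocycles of compact groups -/

/-- A continuous cocycle of a compact group is a coboundary. -/
theorem exists_coboundary {K W : Type*} [Group K] [TopologicalSpace K] [IsTopologicalGroup K]
    [CompactSpace K] [NormedAddCommGroup W] [NormedSpace ℝ W] [FiniteDimensional ℝ W]
    (ρ : K → W →ₗ[ℝ] W) (c : K → W) (hc : Continuous c)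
    (h : ∀ a b, c (a * b) = c a + ρ a (c b)) : ∃ A, ∀ a, c a = A - ρ a A := by
  borelize K
  -- Normalized on the whole compact group, so the total mass is `1`.
  let μ : Measure K := Measure.haarMeasure ⊤
  have hμ : μ.real Set.univ = 1 := by
    have := Measure.haarMeasure_self (K₀ := (⊤ : TopologicalSpace.PositiveCompacts K))
    rw [measureReal_def]
    erw [this]
    simp
  have hint : ∀ f : K → W, Continuous f → Integrable f μ := fun f hf =>
    hf.integrable_of_hasCompactSupport (HasCompactSupport.of_compactSpace f)
  have : CompleteSpace W := FiniteDimensional.complete ℝ W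
  refine ⟨∫ b, c b ∂μ, fun a => ?_⟩
  -- With `A` the mean of `c`, averaging the cocycle identity over `b` gives `A = c a + ρ a A` by
  -- left invariance.
  have h1 : ∫ b, c (a * b) ∂μ = ∫ b, c b ∂μ := integral_mul_left_eq_self c a
  have hρ : Continuous (ρ a) := (ρ a).continuous_of_finiteDimensional
  have h2 : ∫ b, ρ a (c b) ∂μ = ρ a (∫ b, c b ∂μ) :=
    (LinearMap.toContinuousLinearMap (ρ a)).integral_comp_comm (hint c hc)
  simp only [h] at h1
  rw [integral_add (hint _ continuous_const) (hint (fun b => ρ a (c b)) (hρ.comp hc)), h2,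
    integral_const, hμ, one_smul] at h1
  exact eq_sub_of_add_eq h1

/-! ### Quarter turns -/

namespace SO

variable {d : ℕ}

/-- The rotation by a right angle in the plane of two coordinates. -/
def quarterTurn (i j : Fin d) (h : i ≠ j) : SO d :=
  ofMatrix (Matrix.diagonal (Function.update 1 i (-1)) * (Equiv.swap i j).permMatrix ℝ)
    (by
      have hP : (Equiv.swap i j).permMatrix ℝ * ((Equiv.swap i j).permMatrix ℝ).transpose
          = 1 := by
        rw [Matrix.transpose_permMatrix, ← Matrix.permMatrix_mul]
        simp
      rw [Matrix.transpose_mul, Matrix.mul_assoc, ← Matrix.mul_assoc (Equiv.Perm.permMatrix _ _),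
        hP, Matrix.one_mul, Matrix.diagonal_transpose, Matrix.diagonal_mul_diagonal,
        ← Matrix.diagonal_one]
      congr 1
      funext k
      by_cases hk : k = i
      · subst hk; simp
      · simp [hk])
    (by
      rw [Matrix.det_mul, Matrix.det_diagonal, Matrix.det_permutation,
        Finset.prod_update_of_mem (Finset.mem_univ i), Equiv.Perm.sign_swap h]
      simp)

theorem quarterTurn_mul_apply {β : Type*} {i j : Fin d} (h : i ≠ j)
    (M : Matrix (Fin d) β ℝ) (k : Fin d) (a : β) :
    ((quarterTurn i j h).1 * M) k a
      = Function.update (1 : Fin d → ℝ) i (-1) k * M (Equiv.swap i j k) a := by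
  change ((Matrix.diagonal (Function.update 1 i (-1)) * (Equiv.swap i j).permMatrix ℝ :
    Matrix (Fin d) (Fin d) ℝ) * M) k a = _
  rw [Matrix.mul_assoc, Matrix.diagonal_mul, Equiv.Perm.permMatrix,
    PEquiv.toMatrix_toPEquiv_mul]
  rfl

theorem quarterTurn_mul_left {β : Type*} {i j : Fin d} (h : i ≠ j)
    (M : Matrix (Fin d) β ℝ) (a : β) : ((quarterTurn i j h).1 * M) i a = -M j a := by
  simp [quarterTurn_mul_apply]

theorem quarterTurn_mul_right {β : Type*} {i j : Fin d} (h : i ≠ j)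
    (M : Matrix (Fin d) β ℝ) (a : β) : ((quarterTurn i j h).1 * M) j a = M i a := by
  simp [quarterTurn_mul_apply, h.symm]

theorem quarterTurn_mul_of_ne {β : Type*} {i j k : Fin d} (h : i ≠ j) (hi : k ≠ i) (hj : k ≠ j)
    (M : Matrix (Fin d) β ℝ) (a : β) : ((quarterTurn i j h).1 * M) k a = M k a := by
  simp [quarterTurn_mul_apply, hi, Equiv.swap_apply_of_ne_of_ne hi hj]

/-- A half turn is `-1` on its plane. This sign is what makes invariant additive maps vanish. -/
theorem quarterTurn_mul_mul_single {β : Type*} [DecidableEq β] {i j : Fin d} (h : i ≠ j)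
    (a : β) (x : ℝ) :
    (quarterTurn i j h).1 * ((quarterTurn i j h).1 * Matrix.single i a x)
      = -Matrix.single i a x := by
  ext k b
  by_cases hi : k = i
  · subst hi
    rw [quarterTurn_mul_left, quarterTurn_mul_right, Matrix.neg_apply]
  · by_cases hj : k = j
    · subst hj
      rw [quarterTurn_mul_right, quarterTurn_mul_left, Matrix.neg_apply]
    · rw [quarterTurn_mul_of_ne h hi hj, quarterTurn_mul_of_ne h hi hj]
      simp [Ne.symm hi]

theorem quarterTurn_mul_single {β : Type*} [DecidableEq β] {i j : Fin d} (h : i ≠ j)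
    (a : β) (x : ℝ) : (quarterTurn i j h).1 * Matrix.single i a x = Matrix.single j a x := by
  ext k b
  by_cases hi : k = i
  · subst hi
    rw [quarterTurn_mul_left]
    simp [h, h.symm]
  · by_cases hj : k = j
    · subst hj
      rw [quarterTurn_mul_right]
      simp [Matrix.single_apply]
    · rw [quarterTurn_mul_of_ne h hi hj]
      simp [Ne.symm hi, Ne.symm hj]

end SO

/-! ### Homomorphisms of `TFG` to vector spaces -/

variable {d n m s t : ℕ}

theorem TFG.eq_mul (T : TFG d n m) : T = TFG.ofRr 1 T.r * TFG.ofRr T.R 0 := by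
  rw [TFG.ofRr_mul]
  simp [TFG.ofRr_self]

theorem TFG.ofRr_comm (R : SO d) (r : Matrix (Fin d) (Fin n ⊕ Fin m) ℝ) :
    TFG.ofRr R 0 * TFG.ofRr 1 r = TFG.ofRr 1 (R.1 * r) * TFG.ofRr R 0 := by
  simp [TFG.ofRr_mul]

/-- For `d ≥ 2`, continuous homomorphisms from `TFG` to a vector space vanish. -/
theorem TFG.hom_eq_zero {W : Type*} [NormedAddCommGroup W] [NormedSpace ℝ W]
    [FiniteDimensional ℝ W] (hd : 2 ≤ d) (φ : TFG d n m → W) (hc : Continuous φ)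
    (h : ∀ a b, φ (a * b) = φ a + φ b) (T : TFG d n m) : φ T = 0 := by
  -- For the trivial action a coboundary is `A - A = 0`.
  have hrot : ∀ R : SO d, φ (TFG.ofRr R 0) = 0 := by
    obtain ⟨A, hA⟩ := exists_coboundary (fun _ => LinearMap.id)
      (fun R : SO d => φ (TFG.ofRr R 0))
      (hc.comp (TFG.continuous_ofRr continuous_id continuous_const))
      (fun a b => by rw [LinearMap.id_apply, ← h, TFG.ofRr_mul]; simp)
    exact fun R => by rw [hA]; simp
  -- The target is commutative and rotations map to `0`, so conjugating a translation by a rotation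
  -- does not change its image.
  have hinv : ∀ (R : SO d) r, φ (TFG.ofRr 1 (R.1 * r)) = φ (TFG.ofRr 1 r) := fun R r => by
    have := congrArg φ (TFG.ofRr_comm R r)
    rw [h, h, hrot, zero_add, add_zero] at this
    exact this.symm
  let v : Matrix (Fin d) (Fin n ⊕ Fin m) ℝ →+ W :=
    AddMonoidHom.mk' (fun r => φ (TFG.ofRr 1 r)) fun r r' => by
      rw [← h, TFG.ofRr_mul]; simp
  have hv : ∀ r, v r = 0 := by
    intro r
    rw [Matrix.matrix_eq_sum_single r, map_sum]
    refine Finset.sum_eq_zero fun i _ => ?_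
    rw [map_sum]
    refine Finset.sum_eq_zero fun a _ => ?_
    -- Only here is `2 ≤ d` needed: a half turn requires a second coordinate.
    obtain ⟨j, hj⟩ : ∃ j : Fin d, i ≠ j := by
      have : Nontrivial (Fin d) := Fin.nontrivial_iff_two_le.2 hd
      obtain ⟨j, hj⟩ := exists_ne i
      exact ⟨j, hj.symm⟩
    have h1 : v (-Matrix.single i a (r i a)) = v (Matrix.single i a (r i a)) := by
      rw [← SO.quarterTurn_mul_mul_single hj]
      exact (hinv _ _).trans (hinv _ _)
    rw [map_neg] at h1
    have h2 : (2 : ℝ) • v (Matrix.single i a (r i a)) = 0 := by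
      rw [two_smul]
      nth_rewrite 1 [← h1]
      exact neg_add_cancel _
    exact (smul_eq_zero.1 h2).resolve_left two_ne_zero
  rw [TFG.eq_mul T, h, hrot, add_zero]
  exact hv T.r

/-! ### The commutant of `SO(d)` -/

/-- Left multiplication by a matrix as a linear map. -/
def mulLeftMap {α β γ : Type*} [Fintype β] (A : Matrix α β ℝ) :
    Matrix β γ ℝ →ₗ[ℝ] Matrix α γ ℝ where
  toFun r := A * r
  map_add' := Matrix.mul_add A
  map_smul' c r := Matrix.mul_smul A c r

@[simp] theorem mulLeftMap_apply {α β γ : Type*} [Fintype β] (A : Matrix α β ℝ)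
    (r : Matrix β γ ℝ) : mulLeftMap A r = A * r := rfl

/-- Right multiplication by a matrix as a linear map. -/
def mulRightMap {α β γ : Type*} [Fintype β] (A : Matrix β γ ℝ) :
    Matrix α β ℝ →ₗ[ℝ] Matrix α γ ℝ where
  toFun r := r * A
  map_add' r r' := Matrix.add_mul r r' A
  map_smul' c r := Matrix.smul_mul c r A

@[simp] theorem mulRightMap_apply {α β γ : Type*} [Fintype β] (A : Matrix β γ ℝ)
    (r : Matrix α β ℝ) : mulRightMap A r = r * A := rfl

/-- Linear maps commuting with the action of `SO(d)`. -/
theorem equivariant_eq {ι : Type*} [Fintype ι] [DecidableEq ι] (hd : d ≠ 2 ∨ Subsingleton ι)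
    (φ : Matrix (Fin d) ι ℝ →ₗ[ℝ] Matrix (Fin d) ι ℝ)
    (hφ : ∀ (R : SO d) r, φ (R.1 * r) = R.1 * φ r) :
    ∃ (Ω : Matrix (Fin d) (Fin d) ℝ) (L : Matrix ι ι ℝ), Ω.transpose = -Ω ∧
      (∀ R : SO d, Ad R Ω = Ω) ∧ ∀ r, φ r = Ω * r + r * L := by
  rcases isEmpty_or_nonempty ι with hι | ⟨⟨a₀⟩⟩
  · exact ⟨0, 0, by simp, by simp [Ad], fun r => Subsingleton.elim _ _⟩
  have hdecomp : ∀ ψ : Matrix (Fin d) ι ℝ →ₗ[ℝ] Matrix (Fin d) ι ℝ,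
      (∀ i a, φ (Matrix.single i a 1) = ψ (Matrix.single i a 1)) → ∀ r, φ r = ψ r := by
    intro ψ h r
    have : φ = ψ := Matrix.ext_linearMap ℝ fun i a => by
      ext1
      simpa using h i a
    rw [this]
  -- The term `r * L` is equivariant on its own, so equivariance of `φ` passes to `Ω * r`. Testing
  -- on the column `a₀` shows that `Ω` commutes with rotations.
  suffices h : ∃ (Ω : Matrix (Fin d) (Fin d) ℝ) (L : Matrix ι ι ℝ), Ω.transpose = -Ω ∧
      ∀ r, φ r = Ω * r + r * L by
    obtain ⟨Ω, L, h1, h2⟩ := h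
    refine ⟨Ω, L, h1, fun R => ?_, h2⟩
    have hcomm : Ω * R.1 = R.1 * Ω := by
      ext i k
      have : Ω * R.1 * Matrix.single k a₀ (1 : ℝ) + R.1 * Matrix.single k a₀ (1 : ℝ) * L
          = R.1 * Ω * Matrix.single k a₀ (1 : ℝ) + R.1 * Matrix.single k a₀ (1 : ℝ) * L := by
        have := hφ R (Matrix.single k a₀ 1)
        rw [h2, h2, Matrix.mul_add, ← Matrix.mul_assoc, ← Matrix.mul_assoc, ← Matrix.mul_assoc]
          at this
        exact this
      have h0 : Ω * R.1 * Matrix.single k a₀ (1 : ℝ) = R.1 * Ω * Matrix.single k a₀ (1 : ℝ) :=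
        add_right_cancel this
      simpa using congrFun₂ h0 i a₀
    rw [Ad, ← hcomm, Matrix.mul_assoc, SO.coe_mul_inv, Matrix.mul_one]
  by_cases h2 : d = 2
  · subst h2
    have hs : Subsingleton ι := hd.resolve_left (by simp)
    -- With one column, the plane is `ℂ` and `φ` is multiplication by the complex number `φ₀`: the
    -- real part goes into `L`, the imaginary part into `J`.
    let φ₀ := φ (Matrix.single 0 a₀ 1)
    set J : Matrix (Fin 2) (Fin 2) ℝ := !![0, -φ₀ 1 a₀; φ₀ 1 a₀, 0] with hJ
    refine ⟨J, Matrix.scalar ι (φ₀ 0 a₀), ?_, ?_⟩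
    · ext i j; fin_cases i <;> fin_cases j <;> simp [hJ]
    · let ψ : Matrix (Fin 2) ι ℝ →ₗ[ℝ] Matrix (Fin 2) ι ℝ :=
        mulLeftMap J + mulRightMap (Matrix.scalar ι (φ₀ 0 a₀))
      refine hdecomp ψ fun i a => ?_
      obtain rfl := Subsingleton.elim a₀ a
      have h1 : φ (Matrix.single 1 a₀ 1) = (SO.quarterTurn (0 : Fin 2) 1 (by simp)).1 * φ₀ := by
        rw [← hφ, SO.quarterTurn_mul_single]
      have hJ0 : ∀ r : Matrix (Fin 2) ι ℝ, (J * r) 0 a₀ = -φ₀ 1 a₀ * r 1 a₀ := fun r => by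
        rw [Matrix.mul_apply, Fin.sum_univ_two]
        simp [hJ]
      have hJ1 : ∀ r : Matrix (Fin 2) ι ℝ, (J * r) 1 a₀ = φ₀ 1 a₀ * r 0 a₀ := fun r => by
        rw [Matrix.mul_apply, Fin.sum_univ_two]
        simp [hJ]
      ext k b
      obtain rfl := Subsingleton.elim a₀ b
      change _ = (J * Matrix.single i a₀ (1 : ℝ)) k a₀
        + (Matrix.single i a₀ (1 : ℝ) * Matrix.scalar ι (φ₀ 0 a₀)) k a₀
      rw [Matrix.scalar_apply, Matrix.mul_diagonal]
      fin_cases i <;> fin_cases k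
      · simp only [Fin.zero_eta, hJ0]; simp [φ₀]
      · simp only [Fin.zero_eta, Fin.mk_one, hJ1]; simp [φ₀]
      · simp only [Fin.zero_eta, Fin.mk_one, hJ0, h1, SO.quarterTurn_mul_left]; simp
      · simp only [Fin.mk_one, hJ1, h1, SO.quarterTurn_mul_right]; simp
  · rcases Nat.eq_zero_or_pos d with rfl | hpos
    · exact ⟨0, 0, by simp, fun r => Subsingleton.elim _ _⟩
    -- From here `d = 1` or `d ≥ 3`, and no `Ω` is needed. The coefficients are read off in a
    -- reference row, and quarter turns carry them to the other rows.
    let i₀ : Fin d := ⟨0, hpos⟩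
    let L : Matrix ι ι ℝ := fun a b => φ (Matrix.single i₀ a 1) i₀ b
    refine ⟨0, L, by simp, fun r => ?_⟩
    rw [Matrix.zero_mul, zero_add]
    refine hdecomp (mulRightMap L) (fun i a => ?_) r
    ext k b
    by_cases hk : k = i
    · subst hk
      have hg : φ (Matrix.single k a 1) k b = L a b := by
        by_cases hi : i₀ = k
        · rw [← hi]
        · rw [← SO.quarterTurn_mul_single hi, hφ, SO.quarterTurn_mul_right]
      rw [hg]
      simp
    -- Two distinct rows exclude `d = 1`, so there is a third coordinate `j`. The quarter turn in
    -- the `(j, k)`-plane fixes `single i a 1`, hence also its image, whose entries in row `k` must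
    -- then vanish.
    · obtain ⟨j, hji, hjk⟩ : ∃ j : Fin d, j ≠ i ∧ j ≠ k := by
        have h3 : 2 < Fintype.card (Fin d) := by
          have := i.isLt; have := k.isLt
          have : (k : ℕ) ≠ i := fun h => hk (Fin.ext h)
          simp; omega
        have h4 : ({i, k} : Finset (Fin d)).card < (Finset.univ : Finset (Fin d)).card :=
          lt_of_le_of_lt Finset.card_le_two h3
        obtain ⟨j, -, hj⟩ := Finset.exists_mem_notMem_of_card_lt_card h4
        exact ⟨j, by simpa using hj⟩
      have hfix : (SO.quarterTurn j k hjk).1 * Matrix.single i a (1 : ℝ)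
          = Matrix.single i a 1 := by
        ext l c
        by_cases h1 : l = j
        · subst h1
          rw [SO.quarterTurn_mul_left]
          simp [Ne.symm hji, Ne.symm hk]
        · by_cases h2 : l = k
          · subst h2
            rw [SO.quarterTurn_mul_right]
            simp [Ne.symm hji, Ne.symm hk]
          · rw [SO.quarterTurn_mul_of_ne hjk h1 h2]
      have e := hφ (SO.quarterTurn j k hjk) (Matrix.single i a 1)
      rw [hfix] at e
      have e1 := congrFun₂ e j b
      have e2 := congrFun₂ e k b
      rw [SO.quarterTurn_mul_left] at e1
      rw [SO.quarterTurn_mul_right] at e2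
      have e3 : φ (Matrix.single i a 1) k b = 0 := by linarith
      rw [e3]
      simp [hk]

end MultiFrame

namespace MultiFrame

open TypeII

variable {d n m s t : ℕ}

/-! ### Cocycles of `TFG` -/

/-- `Ad_R` as a linear map. -/
def AdMap (R : SO d) : Matrix (Fin d) (Fin d) ℝ →ₗ[ℝ] Matrix (Fin d) (Fin d) ℝ :=
  mulRightMap (R⁻¹ : SO d).1 ∘ₗ mulLeftMap R.1

theorem AdMap_apply (R : SO d) (A : Matrix (Fin d) (Fin d) ℝ) : AdMap R A = Ad R A := rfl

theorem Ad_mul (R S : SO d) (A : Matrix (Fin d) (Fin d) ℝ) : Ad (R * S) A = Ad R (Ad S A) := by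
  simp only [Ad, mul_inv_rev, Submonoid.coe_mul, Matrix.mul_assoc]

@[simp] theorem Ad_one (A : Matrix (Fin d) (Fin d) ℝ) : Ad 1 A = A := by simp [Ad]

theorem Ad_mul_coe (R : SO d) (A : Matrix (Fin d) (Fin d) ℝ) : Ad R A * R.1 = R.1 * A := by
  rw [Ad, Matrix.mul_assoc, TFG.coe_inv_mul, Matrix.mul_one]

theorem Ad_transpose (R : SO d) (A : Matrix (Fin d) (Fin d) ℝ) :
    (Ad R A).transpose = Ad R A.transpose := by
  simp only [Ad, SO.coe_inv, Matrix.transpose_mul, Matrix.transpose_transpose, Matrix.mul_assoc]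

theorem mem_Skew {A : Matrix (Fin d) (Fin d) ℝ} : A ∈ Skew d ↔ A.transpose = -A :=
  LieAlgebra.Orthogonal.mem_so (Fin d) ℝ A

theorem Ad_mem_Skew (R : SO d) {A : Matrix (Fin d) (Fin d) ℝ} (h : A ∈ Skew d) :
    Ad R A ∈ Skew d := by
  rw [mem_Skew] at h ⊢
  rw [Ad_transpose, h, ← AdMap_apply, map_neg, AdMap_apply]

open scoped Matrix.Norms.Elementwise in
/-- Continuous cocycles of `SO(d)` with values in the skew-symmetric matrices. -/
theorem exists_coboundary_Ad (c : SO d → Matrix (Fin d) (Fin d) ℝ) (hc : Continuous c)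
    (hs : ∀ R, c R ∈ Skew d) (h : ∀ R S, c (R * S) = c R + Ad R (c S)) :
    ∃ A ∈ Skew d, ∀ R, c R = A - Ad R A := by
  obtain ⟨B, hB⟩ := exists_coboundary AdMap c hc h
  -- The averaging lemma does not say that `B` is skew. As `c` is skew and `Ad` commutes with
  -- transposition, the skew part of `B` serves equally well.
  refine ⟨(1 / 2 : ℝ) • (B - B.transpose), ?_, fun R => ?_⟩
  · rw [mem_Skew, Matrix.transpose_smul, Matrix.transpose_sub, Matrix.transpose_transpose,
      ← smul_neg, neg_sub]
  · have h1 := mem_Skew.1 (hs R)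
    rw [hB R, Matrix.transpose_sub, AdMap_apply, Ad_transpose] at h1
    have h2 : c R = (1 / 2 : ℝ) • ((B - Ad R B) - (B.transpose - Ad R B.transpose)) := by
      rw [h1, sub_neg_eq_add, ← two_smul ℝ, smul_smul, hB R, AdMap_apply]
      norm_num
    rw [h2, ← AdMap_apply, ← AdMap_apply, ← AdMap_apply, map_smul, map_sub]
    module

open scoped Matrix.Norms.Elementwise in
/-- Continuous cocycles of `SO(d)` with values in the vector components. -/
theorem exists_coboundary_vec {ι : Type*} [Fintype ι] (c : SO d → Matrix (Fin d) ι ℝ)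
    (hc : Continuous c) (h : ∀ R S, c (R * S) = c R + R.1 * c S) :
    ∃ a : Matrix (Fin d) ι ℝ, ∀ R, c R = a - R.1 * a :=
  exists_coboundary (fun R : SO d =>
    (mulLeftMap R.1 : Matrix (Fin d) ι ℝ →ₗ[ℝ] Matrix (Fin d) ι ℝ)) c hc h

/-- A symmetric bilinear map that is skew-symmetric in the last argument vanishes. -/
theorem skew_symm_eq_zero {ι : Type*} [Fintype ι]
    (u : Matrix (Fin d) ι ℝ → Matrix (Fin d) (Fin d) ℝ) (hs : ∀ r, (u r).transpose = -u r)
    (hu : ∀ r q, u r * q = u q * r) (r q : Matrix (Fin d) ι ℝ) : u r * q = 0 := by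
  have h1 : ∀ r q w : Matrix (Fin d) ι ℝ, (w.transpose * (u r * q)).trace = -(q.transpose * (u r * w)).trace := by
    intro r q w
    rw [← Matrix.trace_transpose, Matrix.transpose_mul, Matrix.transpose_mul, hs,
      Matrix.transpose_transpose, Matrix.mul_neg, Matrix.neg_mul, Matrix.trace_neg,
      Matrix.mul_assoc]
  -- The trilinear expression `⟨w, u(r) q⟩` is symmetric in `r, q` and antisymmetric in `q, w`.
  -- Permuting the arguments cyclically shows that it equals its own negative.
  have h2 : ∀ w : Matrix (Fin d) ι ℝ, (w.transpose * (u r * q)).trace = 0 := by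
    intro w
    have e1 := h1 r q w
    have e2 := h1 w r q
    have e3 := h1 q w r
    rw [hu r w] at e1
    rw [hu w q] at e2
    rw [hu q r] at e3
    linarith
  -- Testing against itself gives the squared Frobenius norm.
  have h3 := h2 (u r * q)
  rw [← Matrix.conjTranspose_eq_transpose_of_trivial] at h3
  exact Matrix.trace_conjTranspose_mul_self_eq_zero_iff.1 h3

/-- Cocycles of `TFG` with values in its Lie algebra that vanish on rotations. -/
theorem normalized_cocycle (hd : d ≠ 2 ∨ n + m ≤ 1)
    (b : TFG d n m → Matrix (Fin d) (Fin d) ℝ)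
    (v : TFG d n m → Matrix (Fin d) (Fin n ⊕ Fin m) ℝ) (hv : Continuous v)
    (hs : ∀ T, b T ∈ Skew d) (h1 : ∀ S T, b (S * T) = b S + Ad S.R (b T))
    (h2 : ∀ S T, v (S * T) = v S + S.R.1 * v T - Ad S.R (b T) * S.r)
    (hb0 : ∀ R, b (TFG.ofRr R 0) = 0) (hv0 : ∀ R, v (TFG.ofRr R 0) = 0) :
    ∃ (Ω : Matrix (Fin d) (Fin d) ℝ) (L : Matrix (Fin n ⊕ Fin m) (Fin n ⊕ Fin m) ℝ),
      Ω ∈ Skew d ∧ (∀ R : SO d, Ad R Ω = Ω) ∧ ∀ T, b T = 0 ∧ v T = Ω * T.r + T.r * L := by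
  have hmul : ∀ r q : Matrix (Fin d) (Fin n ⊕ Fin m) ℝ,
      (TFG.ofRr 1 r * TFG.ofRr 1 q : TFG d n m) = TFG.ofRr 1 (r + q) := fun r q => by
    simp [TFG.ofRr_mul]
  have hv' : ∀ r q : Matrix (Fin d) (Fin n ⊕ Fin m) ℝ, v (TFG.ofRr 1 (r + q)) =
      v (TFG.ofRr 1 r) + v (TFG.ofRr 1 q) - b (TFG.ofRr 1 q) * r := fun r q => by
    rw [← hmul, h2]; simp
  -- Translations commute, so the correction term in `hv'` must be symmetric.
  have hsymm : ∀ r q : Matrix (Fin d) (Fin n ⊕ Fin m) ℝ,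
      b (TFG.ofRr 1 r : TFG d n m) * q = b (TFG.ofRr 1 q) * r := fun r q => by
    have e := hv' r q
    rw [add_comm r q, hv' q r, add_comm (v (TFG.ofRr 1 q))] at e
    exact sub_right_injective e
  have hzero := skew_symm_eq_zero (fun r => b (TFG.ofRr 1 r : TFG d n m))
    (fun r => mem_Skew.1 (hs _)) hsymm
  have hb1 : ∀ r, b (TFG.ofRr 1 r) = 0 := by
    intro r
    -- Some column is needed to test the rotation part; without columns every translation is
    -- trivial.
    rcases isEmpty_or_nonempty (Fin n ⊕ Fin m) with hι | ⟨⟨a⟩⟩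
    · rw [Subsingleton.elim r 0, hb0]
    · ext i j
      have h0 : b (TFG.ofRr 1 r) * Matrix.single j a (1 : ℝ) = 0 := hzero r _
      simpa using congrFun₂ h0 i a
  have hb : ∀ T, b T = 0 := fun T => by
    rw [TFG.eq_mul T, h1, hb1, hb0]; simp [Ad]
  -- With the rotation part gone, `v` is additive on translations. Continuity makes it real-linear,
  -- and evaluating `v` on both sides of `TFG.ofRr_comm` makes it equivariant.
  let w : Matrix (Fin d) (Fin n ⊕ Fin m) ℝ →+ Matrix (Fin d) (Fin n ⊕ Fin m) ℝ :=
    AddMonoidHom.mk' (fun r => v (TFG.ofRr 1 r)) fun r q => by rw [hv', hb1]; simp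
  have hw : Continuous w := hv.comp (TFG.continuous_ofRr continuous_const continuous_id)
  obtain ⟨Ω, L, hΩ, hΩR, hL⟩ := equivariant_eq (d := d) (ι := Fin n ⊕ Fin m)
    (hd.imp id fun h => Fintype.card_le_one_iff_subsingleton.1 (by simpa using h))
    (w.toRealLinearMap hw).toLinearMap (fun R r => by
      have e := congrArg v (TFG.ofRr_comm (n := n) (m := m) R r)
      rw [h2, h2, hb, hb, hv0] at e
      have e' : v (TFG.ofRr 1 (R.1 * r)) = R.1 * v (TFG.ofRr 1 r) := by
        simpa [Ad] using e.symm
      exact e')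
  refine ⟨Ω, L, mem_Skew.2 hΩ, hΩR, fun T => ⟨hb T, ?_⟩⟩
  rw [← hL T.r]
  conv_lhs => rw [TFG.eq_mul T, h2, hb, hv0]
  simp [Ad]
  rfl

/-- Continuous cocycles of `TFG` with values in its Lie algebra. -/
theorem cocycle_eq (hd : d ≠ 2 ∨ n + m ≤ 1)
    (b : TFG d n m → Matrix (Fin d) (Fin d) ℝ) (hb : Continuous b)
    (v : TFG d n m → Matrix (Fin d) (Fin n ⊕ Fin m) ℝ) (hv : Continuous v)
    (hs : ∀ T, b T ∈ Skew d) (h1 : ∀ S T, b (S * T) = b S + Ad S.R (b T))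
    (h2 : ∀ S T, v (S * T) = v S + S.R.1 * v T - Ad S.R (b T) * S.r) :
    ∃ (A : Matrix (Fin d) (Fin d) ℝ) (a : Matrix (Fin d) (Fin n ⊕ Fin m) ℝ)
      (L : Matrix (Fin n ⊕ Fin m) (Fin n ⊕ Fin m) ℝ), A ∈ Skew d ∧
      ∀ T, b T = A - Ad T.R A ∧ v T = a - T.R.1 * a + Ad T.R A * T.r + T.r * L := by
  have hrot : Continuous fun R : SO d => (TFG.ofRr R 0 : TFG d n m) :=
    TFG.continuous_ofRr continuous_id continuous_const
  have hmul : ∀ R S : SO d, (TFG.ofRr (R * S) 0 : TFG d n m) = TFG.ofRr R 0 * TFG.ofRr S 0 :=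
    fun R S => by simp [TFG.ofRr_mul]
  obtain ⟨A, hA, hbA⟩ := exists_coboundary_Ad (fun R => b (TFG.ofRr R 0)) (hb.comp hrot)
    (fun R => hs _) (fun R S => by rw [hmul, h1]; simp)
  obtain ⟨a, hva⟩ := exists_coboundary_vec (fun R => v (TFG.ofRr R 0)) (hv.comp hrot)
    (fun R S => by rw [hmul, h2]; simp)
  have cR : Continuous fun T : TFG d n m => T.R.1 :=
    continuous_subtype_val.comp TFG.continuous_R
  have cRi : Continuous fun T : TFG d n m => (T.R⁻¹ : SO d).1 :=
    continuous_subtype_val.comp TFG.continuous_R.inv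
  have cA : Continuous fun T : TFG d n m => Ad T.R A :=
    (cR.matrix_mul continuous_const).matrix_mul cRi
  -- What is subtracted is the coboundary `X - T X T⁻¹` of `X = [A, a; 0, 0]`; the difference
  -- vanishes on rotations.
  obtain ⟨Ω, L, hΩ, hΩR, h⟩ := normalized_cocycle hd
    (fun T => b T - (A - Ad T.R A)) (fun T => v T - (a - T.R.1 * a + Ad T.R A * T.r))
    (hv.sub ((continuous_const.sub (cR.matrix_mul continuous_const)).add
      (cA.matrix_mul TFG.continuous_r)))
    (fun T => sub_mem (hs T) (sub_mem hA (Ad_mem_Skew _ hA)))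
    (fun S T => by
      simp only [h1, TFG.mul_R, Ad_mul]
      simp only [← AdMap_apply, map_sub]
      abel)
    (fun S T => by
      have e : Ad S.R (Ad T.R A) * (S.R.1 * T.r) = S.R.1 * (Ad T.R A * T.r) := by
        rw [← Matrix.mul_assoc, Ad_mul_coe, Matrix.mul_assoc]
      simp only [h2, TFG.mul_R, TFG.r_mul, Ad_mul, Matrix.mul_add, e]
      simp only [← AdMap_apply, map_sub, Matrix.mul_add, Matrix.mul_sub, Matrix.sub_mul,
        Submonoid.coe_mul, Matrix.mul_assoc]
      abel)
    (fun R => by rw [hbA]; simp) (fun R => by rw [hva]; simp)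
  -- As `Ad R Ω = Ω`, adding `Ω` to `A` leaves the rotation part unchanged and contributes exactly
  -- `Ω * r` to the vector part.
  refine ⟨A + Ω, a, L, add_mem hA hΩ, fun T => ?_⟩
  obtain ⟨e1, e2⟩ := h T
  have e3 : Ad T.R (A + Ω) = Ad T.R A + Ω := by
    rw [← AdMap_apply, map_add, AdMap_apply, AdMap_apply, hΩR]
  rw [e3]
  refine ⟨by rw [sub_eq_zero.1 e1]; abel, ?_⟩
  rw [sub_eq_iff_eq_add.1 e2, Matrix.add_mul]
  abel

/-! ### Block velocities -/

/-- `M` is the matrix of a tangent vector at `T`. -/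
def IsVelAt (T : TFG d n m) (M : Blk d n m) : Prop :=
  ∃ V : TFGVel d n m, M = velMat V ∧ IsTangentTFG T V

theorem IsTangentTFG.mul_inv {T : TFG d n m} {V : TFGVel d n m} (h : IsTangentTFG T V) :
    V.1 * (T.R⁻¹ : SO d).1 ∈ Skew d := by
  have := Ad_mem_Skew T.R h
  rwa [Ad, SO.mul_inv_mul] at this

/-- In the product, the body velocity of `S` is conjugated by `T.R⁻¹` and added to that of `T`; skew
matrices are stable under both operations. -/
theorem IsVelAt.mul {S T : TFG d n m} {M N : Blk d n m} (hM : IsVelAt S M)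
    (hN : IsVelAt T N) : IsVelAt (S * T) (M * T.toMat + S.toMat * N) := by
  obtain ⟨V, rfl, hV⟩ := hM
  obtain ⟨W, rfl, hW⟩ := hN
  refine ⟨(V.1 * T.R.1 + S.R.1 * W.1, V.1 * T.r + V.2 + S.R.1 * W.2), ?_, ?_⟩
  · simp only [velMat_eq, toMat_eq, blk_mul, blk_add]
    simp
  · have h1 := Ad_mem_Skew T.R⁻¹ hV
    have h2 := add_mem h1 hW
    rw [Ad, inv_inv] at h2
    simp only [IsTangentTFG, TFG.mul_R, mul_inv_rev, Submonoid.coe_mul, Matrix.mul_add,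
      Matrix.mul_assoc, SO.inv_mul_mul] at h2 ⊢
    exact h2

theorem isVelAt_lblockVel {χ : MFG d n m s t} {V : MFGVel d n m s t} (h : IsTangent χ V)
    {j : ℕ} (hj : j ≤ s) : IsVelAt (χ.lchain j) (lblockVel χ V j) := by
  induction j with
  | zero => exact ⟨_, rfl, h.1⟩
  | succ i ih =>
    have hi : i < s := hj
    refine IsVelAt.mul ⟨lvel V (i + 1), rfl, ?_⟩ (ih hi.le)
    simpa [lvel, lseq, hi] using h.2.1 ⟨i, hi⟩

theorem isVelAt_rblockVel {χ : MFG d n m s t} {V : MFGVel d n m s t} (h : IsTangent χ V)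
    {j : ℕ} (hj : j ≤ t) : IsVelAt (χ.rchain j) (rblockVel χ V j) := by
  induction j with
  | zero => exact ⟨_, rfl, h.1⟩
  | succ i ih =>
    have hi : i < t := hj
    refine IsVelAt.mul (ih hi.le) ⟨rvel V (i + 1), rfl, ?_⟩
    simpa [rvel, rseq, hi] using h.2.2 ⟨i, hi⟩

/-! ### Affine fields on a product of copies of `TFG` -/

open scoped Matrix.Norms.Elementwise in
/-- A cocycle along one factor of a product only depends on this factor. -/
theorem cocycle_depends {J : Type*} [Finite J] [DecidableEq J]
    (hJ : 2 ≤ d ∨ Subsingleton (TFG d n m) ∨ Subsingleton J) (i : J)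
    (c : (J → TFG d n m) → Blk d n m) (hc : Continuous c)
    (h : ∀ a b, c (a * b) = c a + (a i).toMat * c b * (a i)⁻¹.toMat) (a : J → TFG d n m) :
    c a = c (Pi.mulSingle i (a i)) := by
  rcases hJ with hd | hT | hJ
  · have h1 : ∀ a b, a i = 1 → c (a * b) = c a + c b := fun a b hab => by
      rw [h, hab, inv_one, TFG.toMat_one, one_mul, mul_one]
    have h0 : c 1 = 0 := by simpa using h1 1 1 rfl
    have hu : Function.update (1 : J → TFG d n m) i 1 = 1 := Function.update_eq_self i _
    -- Erasing the `i`-th coordinate turns `c` into a homomorphism of the whole product. On a finite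
    -- product it is determined by its restrictions to the factors.
    let φ : (J → TFG d n m) →* Multiplicative (Blk d n m) :=
      { toFun := fun a => Multiplicative.ofAdd (c (Function.update a i 1))
        map_one' := by rw [hu, h0]; rfl
        map_mul' := fun a b => by
          rw [← ofAdd_add, ← h1 _ _ (Function.update_self _ _ _), ← Function.update_mul,
            mul_one] }
    have hφ : φ = 1 := by
      refine MonoidHom.pi_ext fun k x => ?_
      change c (Function.update (Pi.mulSingle k x) i 1) = 0
      by_cases hk : k = i
      · subst hk
        rw [Pi.mulSingle, Function.update_idem, hu, h0]
      · have hs : ∀ y : TFG d n m, (Pi.mulSingle k y : J → TFG d n m) i = 1 := fun y =>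
          Pi.mulSingle_eq_of_ne (M := fun _ => TFG d n m) (Ne.symm hk) y
        rw [Function.update_eq_self_iff.2 (hs x).symm]
        exact TFG.hom_eq_zero hd (fun y => c (Pi.mulSingle k y))
          (hc.comp (continuous_mulSingle (A := fun _ : J => TFG d n m) k))
          (fun y z => by rw [Pi.mulSingle_mul, h1 _ _ (hs y)]) x
    have h2 : c (Function.update a i 1) = 0 := DFunLike.congr_fun hφ a
    -- The first factor has trivial `i`-th coordinate, so it contributes additively, and its
    -- contribution is zero.
    have h3 : a = Function.update a i 1 * Pi.mulSingle i (a i) := by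
      funext k
      by_cases hk : k = i
      · subst hk; simp
      · simp [hk]
    conv_lhs => rw [h3, h1 _ _ (Function.update_self _ _ _), h2, zero_add]
  · exact congrArg c (Subsingleton.elim _ _)
  · congr 1
    funext k
    rw [Subsingleton.elim k i, Pi.mulSingle_eq_same]

/-- The form of an affine field along one factor of a product of copies of `TFG`. -/
theorem affine_field_eq {J : Type*} [Finite J] [DecidableEq J] (hd : d ≠ 2 ∨ n + m ≤ 1)
    (hJ : 2 ≤ d ∨ Subsingleton (TFG d n m) ∨ Subsingleton J) (i : J)
    (F : (J → TFG d n m) → Blk d n m) (hc : Continuous F) (ht : ∀ a, IsVelAt (a i) (F a))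
    (h : ∀ a b, F (a * b) = F a * (b i).toMat + (a i).toMat * F b
      - (a i).toMat * F 1 * (b i).toMat) :
    ∃ (θ ω : Skew d) (γ ρ : Matrix (Fin d) (Fin n ⊕ Fin m) ℝ)
      (L : Matrix (Fin n ⊕ Fin m) (Fin n ⊕ Fin m) ℝ), ∀ a,
      F a = blk θ.1 γ (-L) * (a i).toMat + (a i).toMat * blk ω.1 ρ L := by
  -- Right translation to the identity, normalized to vanish there, turns the affine identity into
  -- the cocycle identity.
  let c : (J → TFG d n m) → Blk d n m := fun a => F a * (a i)⁻¹.toMat - F 1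
  have hcc : Continuous c := (hc.matrix_mul
    (TFG.continuous_toMat.comp (continuous_apply i).inv)).sub continuous_const
  have hcmul : ∀ a b, c (a * b) = c a + (a i).toMat * c b * (a i)⁻¹.toMat := by
    intro a b
    have e1 : (b i).toMat * (b i)⁻¹.toMat = 1 := TFG.toMat_mul_inv _
    have e2 : ∀ M : Blk d n m, (b i).toMat * ((b i)⁻¹.toMat * M) = M := fun M => by
      rw [← mul_assoc, e1, one_mul]
    simp only [c, h, Pi.mul_apply, mul_inv_rev, TFG.toMat_mul, sub_mul, add_mul, mul_sub,
      mul_assoc, e2]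
    abel
  choose V hV hVt using ht
  let b : TFG d n m → Matrix (Fin d) (Fin d) ℝ := fun T => (c (Pi.mulSingle i T)).toBlocks₁₁
  let v : TFG d n m → Matrix (Fin d) (Fin n ⊕ Fin m) ℝ :=
    fun T => (c (Pi.mulSingle i T)).toBlocks₁₂
  have hcV : ∀ a, c a = blk ((V a).1 * ((a i).R⁻¹ : SO d).1 - (V 1).1)
      ((V a).1 * (a i)⁻¹.r + (V a).2 - (V 1).2) 0 := by
    intro a
    simp only [c, hV, velMat_eq, toMat_eq, blk_mul, blk_sub]
    simp
  have hbv : ∀ T, c (Pi.mulSingle i T) = blk (b T) (v T) 0 := by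
    intro T
    simp only [b, v, hcV, blk, Matrix.toBlocks_fromBlocks₁₁, Matrix.toBlocks_fromBlocks₁₂]
  have hsingle : Continuous fun T => c (Pi.mulSingle i T) := hcc.comp (continuous_mulSingle (A := fun _ : J => TFG d n m) i)
  have hb : Continuous b := continuous_matrix fun k l => hsingle.matrix_elem _ _
  have hv : Continuous v := continuous_matrix fun k l => hsingle.matrix_elem _ _
  have hV1 : (V 1).1 ∈ Skew d := by
    have := hVt 1
    simpa [IsTangentTFG] using this
  have hs : ∀ T, b T ∈ Skew d := by
    intro T
    have e := hbv T
    rw [hcV] at e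
    rw [← (blk_inj.1 e).1]
    exact sub_mem (hVt _).mul_inv hV1
  have hblk : ∀ S T : TFG d n m, blk (b (S * T)) (v (S * T)) 0 = blk (b S) (v S) 0
      + S.toMat * blk (b T) (v T) 0 * S⁻¹.toMat := by
    intro S T
    rw [← hbv, ← hbv, ← hbv, Pi.mulSingle_mul, hcmul]
    simp
  have hblk' : ∀ S T : TFG d n m, b (S * T) = b S + Ad S.R (b T) ∧
      v (S * T) = v S + S.R.1 * v T - Ad S.R (b T) * S.r := by
    intro S T
    have e := hblk S T
    simp only [toMat_eq, blk_mul, blk_add] at e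
    obtain ⟨e1, e2, -⟩ := blk_inj.1 e
    refine ⟨e1, e2.trans ?_⟩
    rw [TFG.r_inv, Ad]
    simp only [Matrix.mul_neg, Matrix.mul_zero, add_zero, Matrix.mul_one, Matrix.mul_assoc]
    abel
  obtain ⟨A, a₀, L, hA, hAL⟩ := cocycle_eq hd b hb v hv hs (fun S T => (hblk' S T).1)
    (fun S T => (hblk' S T).2)
  -- With `X = [A, a₀; 0, 0]`, the field is `(X + F 1) T - T X + [0, r L; 0, 0]`. The last term
  -- equals `T D - D T` for `D = [0, 0; 0, L]`, whence the opposite signs of `L`.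
  refine ⟨⟨A + (V 1).1, add_mem hA hV1⟩, ⟨-A, neg_mem hA⟩, a₀ + (V 1).2, -a₀, L, fun a => ?_⟩
  have e : F a = (c a + F 1) * (a i).toMat := by
    simp only [c, sub_add_cancel, mul_assoc, TFG.toMat_inv_mul, mul_one]
  rw [e, cocycle_depends hJ i c hcc hcmul a, hbv, (hAL _).1, (hAL _).2, hV 1]
  simp only [velMat_eq, toMat_eq, blk_mul, blk_add]
  rw [blk_inj]
  refine ⟨?_, ?_, by simp⟩
  · simp only [Matrix.add_mul, Matrix.sub_mul, Ad_mul_coe, Matrix.mul_neg]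
    abel
  · simp only [Matrix.add_mul, Matrix.sub_mul, Matrix.mul_neg, Matrix.mul_one]
    abel

end MultiFrame

namespace MultiFrame

open TypeII

variable {d n m s t : ℕ}

/-! ### Affine fields have the explicit form -/

theorem continuous_velMat : Continuous (velMat : TFGVel d n m → Blk d n m) :=
  continuous_fst.matrix_fromBlocks continuous_snd continuous_const continuous_const

theorem continuous_lvel (j : ℕ) : Continuous fun V : MFGVel d n m s t => lvel V j := by
  cases j with
  | zero => exact continuous_fst
  | succ i =>
    by_cases h : i < s
    · simp only [lvel, h, dite_true]
      exact (continuous_apply _).comp (continuous_fst.comp continuous_snd)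
    · simp only [lvel, h, dite_false]
      exact continuous_const

theorem continuous_rvel (j : ℕ) : Continuous fun V : MFGVel d n m s t => rvel V j := by
  cases j with
  | zero => exact continuous_fst
  | succ i =>
    by_cases h : i < t
    · simp only [rvel, h, dite_true]
      exact (continuous_apply _).comp (continuous_snd.comp continuous_snd)
    · simp only [rvel, h, dite_false]
      exact continuous_const

theorem continuous_lblock (j : ℕ) : Continuous fun χ : MFG d n m s t => lblock χ j :=
  TFG.continuous_toMat.comp (continuous_lchain j)

theorem continuous_rblock (j : ℕ) : Continuous fun χ : MFG d n m s t => rblock χ j :=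
  TFG.continuous_toMat.comp (continuous_rchain j)

theorem continuous_lblockVel {F : MFG d n m s t → MFGVel d n m s t} (hF : Continuous F)
    (j : ℕ) : Continuous fun χ => lblockVel χ (F χ) j := by
  induction j with
  | zero => exact continuous_velMat.comp (continuous_fst.comp hF)
  | succ i ih =>
    exact ((continuous_velMat.comp ((continuous_lvel (i + 1)).comp hF)).matrix_mul
      (continuous_lblock i)).add
      ((TFG.continuous_toMat.comp (continuous_lseq (i + 1))).matrix_mul ih)

theorem continuous_rblockVel {F : MFG d n m s t → MFGVel d n m s t} (hF : Continuous F)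
    (j : ℕ) : Continuous fun χ => rblockVel χ (F χ) j := by
  induction j with
  | zero => exact continuous_velMat.comp (continuous_fst.comp hF)
  | succ i ih =>
    exact (ih.matrix_mul (TFG.continuous_toMat.comp (continuous_rseq (i + 1)))).add
      ((continuous_rblock i).matrix_mul
        (continuous_velMat.comp ((continuous_rvel (i + 1)).comp hF)))

/-- The velocities of all the diagonal blocks. -/
def blockVel (χ : MFG d n m s t) (V : MFGVel d n m s t) : Idx s t → Blk d n m
  | none => velMat V.1
  | some (Sum.inl j) => lblockVel χ V (j + 1)
  | some (Sum.inr j) => rblockVel χ V (j + 1)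

theorem blockVel_lidx (χ : MFG d n m s t) (V : MFGVel d n m s t) {j : ℕ} (hj : j ≤ s) :
    blockVel χ V (lidx j) = lblockVel χ V j := by
  cases j with
  | zero => rfl
  | succ i => simp only [lidx, Nat.lt_of_succ_le hj, dite_true, blockVel]

theorem blockVel_ridx (χ : MFG d n m s t) (V : MFGVel d n m s t) {j : ℕ} (hj : j ≤ t) :
    blockVel χ V (ridx j) = rblockVel χ V j := by
  cases j with
  | zero => rfl
  | succ i => simp only [ridx, Nat.lt_of_succ_le hj, dite_true, blockVel]

theorem continuous_blockVel {F : MFG d n m s t → MFGVel d n m s t} (hF : Continuous F)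
    (i : Idx s t) : Continuous fun χ => blockVel χ (F χ) i := by
  rcases i with _ | j | j
  · exact continuous_lblockVel hF 0
  · exact continuous_lblockVel hF _
  · exact continuous_rblockVel hF _

theorem isVelAt_blockVel {χ : MFG d n m s t} {V : MFGVel d n m s t} (h : IsTangent χ V)
    (i : Idx s t) : IsVelAt (χ.chain i) (blockVel χ V i) := by
  rcases i with _ | j | j
  · exact isVelAt_lblockVel h (Nat.zero_le _)
  · exact isVelAt_lblockVel h j.isLt
  · exact isVelAt_rblockVel h j.isLt

theorem IsGroupAffine.blockVel_mul {U : Type*} {f : U → MFG d n m s t → MFGVel d n m s t}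
    (h : IsGroupAffine f) (u : U) (a b : MFG d n m s t) (i : Idx s t) :
    blockVel (a * b) (f u (a * b)) i = blockVel a (f u a) i * (b.chain i).toMat
      + (a.chain i).toMat * blockVel b (f u b) i
      - (a.chain i).toMat * blockVel 1 (f u 1) i * (b.chain i).toMat := by
  rcases i with _ | j | j
  · exact h.affine_left u a b 0 (Nat.zero_le _)
  · exact h.affine_left u a b (j + 1) j.isLt
  · exact h.affine_right u a b (j + 1) j.isLt

/-- The parameters whose chains have prescribed parameters. -/
def Params.ofChains (s t : ℕ) (θ ω : Idx s t → Skew d)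
    (γ ρ : Idx s t → Matrix (Fin d) (Fin n ⊕ Fin m) ℝ)
    (L : Idx s t → Matrix (Fin n ⊕ Fin m) (Fin n ⊕ Fin m) ℝ) : Params d n m where
  lθ j := θ (lidx j)
  -- Increments along the chain. At `j = 0` truncated subtraction gives the unused value `0`.
  lω j := ω (lidx j) - ω (lidx (j - 1))
  lγ j := γ (lidx j)
  lρ j := ρ (lidx j) - ρ (lidx (j - 1))
  lL j := -L (lidx j)
  rθ j := θ (ridx j) - θ (ridx (j - 1))
  rω j := ω (ridx j)
  rγ j := γ (ridx j) - γ (ridx (j - 1))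
  rρ j := ρ (ridx j)
  rL j := L (ridx j)
  -- Left and right chains of index `0` are both the core.
  L_zero := rfl

section OfChains

variable (θ ω : Idx s t → Skew d) (γ ρ : Idx s t → Matrix (Fin d) (Fin n ⊕ Fin m) ℝ)
  (L : Idx s t → Matrix (Fin n ⊕ Fin m) (Fin n ⊕ Fin m) ℝ)

theorem Params.lΩ_ofChains (j : ℕ) : (Params.ofChains s t θ ω γ ρ L).lΩ j
    = blk (ω (lidx j)).1 (ρ (lidx j)) (L (lidx j)) := by
  induction j with
  | zero => rfl
  | succ i ih =>
    rw [Params.lΩ, ih, Params.lW, blk_add, blk_inj]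
    refine ⟨add_sub_cancel _ _, add_sub_cancel _ _, ?_⟩
    change _ + (-L (lidx i) - -L (lidx (i + 1))) = _
    abel

theorem Params.rΘ_ofChains (j : ℕ) : (Params.ofChains s t θ ω γ ρ L).rΘ j
    = blk (θ (ridx j)).1 (γ (ridx j)) (-L (ridx j)) := by
  induction j with
  | zero => rfl
  | succ i ih =>
    rw [Params.rΘ, ih, Params.rZ, blk_add, blk_inj]
    refine ⟨add_sub_cancel _ _, add_sub_cancel _ _, ?_⟩
    change _ + (L (ridx i) - L (ridx (i + 1))) = _
    abel

end OfChains

/-- A group affine field has the explicit form, apart from low-dimensional exceptions. -/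
theorem exists_explicitField_eq (h1 : d = 1 → n + m = 0 ∨ (s = 0 ∧ t = 0))
    (h2 : d = 2 → n + m ≤ 1) {F : MFG d n m s t → MFGVel d n m s t}
    (hF : IsGroupAffine fun _ : Unit => F) :
    ∃ p : Params d n m, ∀ χ, F χ = explicitField p χ := by
  have hd : d ≠ 2 ∨ n + m ≤ 1 := (em (d = 2)).symm.imp id h2
  -- The low-dimensional hypothesis says: either homomorphisms to vector spaces vanish, or TFG is
  -- trivial, or there is only one chain.
  have hJ : 2 ≤ d ∨ Subsingleton (TFG d n m) ∨ Subsingleton (Idx s t) := by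
    have hsub : Subsingleton (SO d) → Subsingleton (Matrix (Fin d) (Fin n ⊕ Fin m) ℝ) →
        Subsingleton (TFG d n m) := fun _ _ =>
      ⟨fun a b => TFG.ext_r (Subsingleton.elim _ _) (Subsingleton.elim _ _)⟩
    by_cases hd2 : 2 ≤ d
    · exact Or.inl hd2
    rcases (by omega : d = 0 ∨ d = 1) with rfl | rfl
    · exact Or.inr (Or.inl (hsub inferInstance inferInstance))
    · rcases h1 rfl with h | ⟨rfl, rfl⟩
      · refine Or.inr (Or.inl (hsub ⟨fun R S => ?_⟩ ?_))
        · have hone : ∀ R : SO 1, R.1 = 1 := fun R => by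
            have := (Matrix.mem_specialOrthogonalGroup_iff.1 R.2).2
            rw [Matrix.det_fin_one] at this
            ext i j
            rw [Subsingleton.elim i 0, Subsingleton.elim j 0, this, Matrix.one_apply_eq]
          exact Subtype.ext ((hone R).trans (hone S).symm)
        · obtain ⟨rfl, rfl⟩ : n = 0 ∧ m = 0 := by omega
          infer_instance
      · exact Or.inr (Or.inr ⟨by rintro (_ | ⟨⟨_, h⟩⟩ | ⟨⟨_, h⟩⟩) (_ | ⟨⟨_, h'⟩⟩ | ⟨⟨_, h'⟩⟩) <;>
          first | rfl | exact absurd h (Nat.not_lt_zero _) | exact absurd h' (Nat.not_lt_zero _)⟩)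
  -- On the product side each block is an affine field along one factor.
  let e := chainEquiv (TFG d n m) s t
  have hform := fun i : Idx s t => affine_field_eq hd hJ i
    (fun g => blockVel (e.symm g) (F (e.symm g)) i)
    ((continuous_blockVel (hF.continuous ()) i).comp e.symm.continuous)
    (fun g => by
      have := isVelAt_blockVel (hF.tangent () (e.symm g)) i
      rwa [chain_chainEquiv_symm] at this)
    (fun a b => by
      have := hF.blockVel_mul () (e.symm a) (e.symm b) i
      rw [chain_chainEquiv_symm, chain_chainEquiv_symm, ← map_mul] at this
      rw [this, map_one])
  choose θ ω γ ρ L hL using hform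
  refine ⟨Params.ofChains s t θ ω γ ρ L, fun χ => ?_⟩
  have key : ∀ i, blockVel χ (F χ) i = blk (θ i).1 (γ i) (-L i) * (χ.chain i).toMat
      + (χ.chain i).toMat * blk (ω i).1 (ρ i) (L i) := fun i => by
    have := hL i (e χ)
    rwa [e.symm_apply_apply] at this
  refine vel_ext (χ := χ) (fun j hj => ?_) (fun j hj => ?_)
  · rw [lblockVel_explicitField _ _ hj, Params.lΩ_ofChains, ← blockVel_lidx _ _ hj, key,
      chain_lidx _ hj]
    rfl
  · rw [rblockVel_explicitField _ _ hj, Params.rΘ_ofChains, ← blockVel_ridx _ _ hj, key,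
      chain_ridx _ hj]
    rfl

/-! ### The explicit form is group affine -/

theorem isTangent_explicitField (p : Params d n m) (χ : MFG d n m s t) :
    IsTangent χ (explicitField p χ) := by
  have h1 : ∀ (R : SO d) (A : Skew d), (R⁻¹ : SO d).1 * (A.1 * R.1) ∈ Skew d := fun R A => by
    have := Ad_mem_Skew R⁻¹ A.2
    rwa [Ad, inv_inv, Matrix.mul_assoc] at this
  refine ⟨?_, fun j => ?_, fun j => ?_⟩
  · change _ * coreFrame p χ.core ∈ Skew d
    rw [coreFrame, Matrix.mul_add, SO.inv_mul_mul]
    exact add_mem (h1 _ _) (p.rω 0).2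
  · have hR : lR χ (j + 1) = (χ.left j).R := by simp [lR, lseq]
    change _ * leftFrame p χ j ∈ Skew d
    rw [leftFrame, hR, Matrix.mul_add, SO.inv_mul_mul]
    exact add_mem (h1 _ _) (sub_mem (Ad_mem_Skew _ (p.lω _).2) (p.lθ _).2)
  · have hR : rR χ (j + 1) = (χ.right j).R := by simp [rR, rseq]
    change _ * rightFrame p χ j ∈ Skew d
    rw [rightFrame, hR, Matrix.mul_add, SO.inv_mul_mul]
    exact add_mem (h1 _ ⟨_, sub_mem (Ad_mem_Skew _ (p.rθ _).2) (p.rω _).2⟩) (p.rω _).2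

theorem continuous_explicitField (p : Params d n m) :
    Continuous (explicitField p : MFG d n m s t → _) := by
  have cm : ∀ f : MFG d n m s t → SO d, Continuous f → Continuous fun χ => (f χ).1 :=
    fun f hf => continuous_subtype_val.comp hf
  have cAd : ∀ (f : MFG d n m s t → SO d) (A : Matrix (Fin d) (Fin d) ℝ), Continuous f →
      Continuous fun χ => Ad (f χ) A := fun f A hf =>
    ((cm f hf).matrix_mul continuous_const).matrix_mul (cm _ hf.inv)
  have clR : ∀ j, Continuous fun χ : MFG d n m s t => lR χ j := fun j =>
    TFG.continuous_R.comp (continuous_lseq j)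
  have crR : ∀ j, Continuous fun χ : MFG d n m s t => rR χ j := fun j =>
    TFG.continuous_R.comp (continuous_rseq j)
  have clr : ∀ j, Continuous fun χ : MFG d n m s t => lr χ j := fun j =>
    TFG.continuous_r.comp (continuous_lseq j)
  have crr : ∀ j, Continuous fun χ : MFG d n m s t => rr χ j := fun j =>
    TFG.continuous_r.comp (continuous_rseq j)
  have clc : ∀ j, Continuous fun χ : MFG d n m s t => (χ.lchain j).R := fun j =>
    TFG.continuous_R.comp (continuous_lchain j)
  have crc : ∀ j, Continuous fun χ : MFG d n m s t => (χ.rchain j).R := fun j =>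
    TFG.continuous_R.comp (continuous_rchain j)
  have clcr : ∀ j, Continuous fun χ : MFG d n m s t => (χ.lchain j).r := fun j =>
    TFG.continuous_r.comp (continuous_lchain j)
  have crcr : ∀ j, Continuous fun χ : MFG d n m s t => (χ.rchain j).r := fun j =>
    TFG.continuous_r.comp (continuous_rchain j)
  have c0 := fun {α β : Type} (A : Matrix α β ℝ) => continuous_const (X := MFG d n m s t) (y := A)
  refine Continuous.prodMk (Continuous.prodMk ?_ ?_) (Continuous.prodMk
    (continuous_pi fun j => Continuous.prodMk ?_ ?_)
    (continuous_pi fun j => Continuous.prodMk ?_ ?_))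
  · exact ((c0 _).matrix_mul (cm _ (clR 0))).add ((cm _ (clR 0)).matrix_mul (c0 _))
  · exact ((((c0 _).matrix_mul (clr 0)).add (c0 _)).add
      ((cm _ (clR 0)).matrix_mul (c0 _))).add ((clr 0).matrix_mul (c0 _))
  · simp only [leftFrame, ← lchain_R]
    exact ((c0 _).matrix_mul (cm _ (clR _))).add ((cm _ (clR _)).matrix_mul
      ((cAd _ _ (clc _)).sub (c0 _)))
  · simp only [leftVec_eq]
    exact ((((((((cm _ (clR _)).matrix_mul (clcr _)).matrix_mul (c0 _)).sub
      ((cAd _ _ (clc _)).matrix_mul ((cm _ (clR _)).matrix_mul (clcr _)))).add (c0 _)).add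
      ((cm _ (clc _)).matrix_mul (c0 _))).add ((c0 _).matrix_mul (clr _))).sub
      ((cm _ (clR _)).matrix_mul (c0 _))).sub ((clr _).matrix_mul (c0 _))
  · simp only [rightFrame, ← rchain_R]
    exact (((cAd _ _ (crc _).inv).sub (c0 _)).matrix_mul (cm _ (crR _))).add
      ((cm _ (crR _)).matrix_mul (c0 _))
  · simp only [rightVec_eq]
    exact (((((((((cAd _ _ (crc _).inv).matrix_mul
      ((cm _ (crc _).inv).matrix_mul (crcr _))).add
      ((cAd _ _ (crc _).inv).matrix_mul (crr _))).sub (c0 _)).sub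
      (((cm _ (crc _).inv).matrix_mul (crcr _)).matrix_mul (c0 _))).add
      ((cm _ (crR _)).matrix_mul (c0 _))).add ((crr _).matrix_mul (c0 _))).sub
      ((c0 _).matrix_mul (crr _))).add ((cm _ (crc _).inv).matrix_mul (c0 _)))

/-- For `X ↦ ΘX + XΩ` the value at the identity is `Θ + Ω`, and subtracting `a(Θ + Ω)b` removes the
two middle terms of the product rule. -/
theorem isGroupAffine_explicitField {U : Type*} (p : U → Params d n m) :
    IsGroupAffine (fun u => (explicitField (p u) : MFG d n m s t → _)) where
  continuous u := continuous_explicitField (p u)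
  tangent u χ := isTangent_explicitField (p u) χ
  affine_left u a b j hj := by
    have h1 : lblock (1 : MFG d n m s t) j = 1 := by rw [lblock, lchain_one, TFG.toMat_one]
    have h2 : lblock (a * b) j = lblock a j * lblock b j := by
      simp only [lblock, lchain_mul, TFG.toMat_mul]
    simp only [lblockVel_explicitField _ _ hj, h1, h2, mul_add, add_mul, mul_one, one_mul,
      mul_assoc]
    abel
  affine_right u a b j hj := by
    have h1 : rblock (1 : MFG d n m s t) j = 1 := by rw [rblock, rchain_one, TFG.toMat_one]
    have h2 : rblock (a * b) j = rblock a j * rblock b j := by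
      simp only [rblock, rchain_mul, TFG.toMat_mul]
    simp only [rblockVel_explicitField _ _ hj, h1, h2, mul_add, add_mul, mul_one, one_mul,
      mul_assoc]
    abel

end MultiFrame

namespace MultiFrame

open TypeII

variable {d n m s t : ℕ}

/-! ### Derivatives of matrix-valued curves -/

section MatDeriv

variable {α β γ : Type*} {M : ℝ → Matrix α β ℝ} {M' : Matrix α β ℝ} {τ : ℝ}

theorem HasMatDerivAt.unique {M'' : Matrix α β ℝ} (h : HasMatDerivAt M M' τ)
    (h' : HasMatDerivAt M M'' τ) : M' = M'' := by
  ext i j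
  exact (h i j).unique (h' i j)

theorem hasMatDerivAt_const (A : Matrix α β ℝ) : HasMatDerivAt (fun _ => A) 0 τ :=
  fun i j => hasDerivAt_const τ (A i j)

theorem HasMatDerivAt.transpose (h : HasMatDerivAt M M' τ) :
    HasMatDerivAt (fun σ => (M σ).transpose) M'.transpose τ := fun i j => h j i

theorem HasMatDerivAt.neg (h : HasMatDerivAt M M' τ) : HasMatDerivAt (fun σ => -M σ) (-M') τ :=
  fun i j => (h i j).neg

theorem HasMatDerivAt.mul [Fintype β] {N : ℝ → Matrix β γ ℝ} {N' : Matrix β γ ℝ}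
    (h : HasMatDerivAt M M' τ) (hN : HasMatDerivAt N N' τ) :
    HasMatDerivAt (fun σ => M σ * N σ) (M' * N τ + M τ * N') τ := by
  intro i j
  simp only [Matrix.mul_apply, Matrix.add_apply, ← Finset.sum_add_distrib]
  exact HasDerivAt.fun_sum fun k _ => (h i k).mul (hN k j)

theorem hasMatDerivAt_fromBlocks {α' β' : Type*} {A : ℝ → Matrix α β ℝ}
    {B : ℝ → Matrix α β' ℝ} {C : ℝ → Matrix α' β ℝ} {D : ℝ → Matrix α' β' ℝ}
    {A' : Matrix α β ℝ} {B' : Matrix α β' ℝ} {C' : Matrix α' β ℝ} {D' : Matrix α' β' ℝ}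
    (hA : HasMatDerivAt A A' τ) (hB : HasMatDerivAt B B' τ) (hC : HasMatDerivAt C C' τ)
    (hD : HasMatDerivAt D D' τ) :
    HasMatDerivAt (fun σ => Matrix.fromBlocks (A σ) (B σ) (C σ) (D σ))
      (Matrix.fromBlocks A' B' C' D') τ := by
  rintro (i | i) (j | j)
  · exact hA i j
  · exact hB i j
  · exact hC i j
  · exact hD i j

end MatDeriv

theorem hasVelTFG_iff {T : ℝ → TFG d n m} {V : TFGVel d n m} {τ : ℝ} :
    HasVelTFG T V τ ↔ HasMatDerivAt (fun σ => (T σ).toMat) (velMat V) τ :=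
  ⟨fun h => hasMatDerivAt_fromBlocks h.1 h.2 (hasMatDerivAt_const 0) (hasMatDerivAt_const 1),
    fun h => ⟨fun i j => h (Sum.inl i) (Sum.inl j), fun i j => h (Sum.inl i) (Sum.inr j)⟩⟩

/-- The inverse is differentiable because `R⁻¹` is the transpose of `R`. Its derivative is then
forced by differentiating `T T⁻¹ = 1`. -/
theorem hasMatDerivAt_inv {T : ℝ → TFG d n m} {V : TFGVel d n m} {τ : ℝ}
    (h : HasVelTFG T V τ) : HasMatDerivAt (fun σ => (T σ)⁻¹.toMat)
      (-((T τ)⁻¹.toMat * velMat V * (T τ)⁻¹.toMat)) τ := by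
  have hR : HasMatDerivAt (fun σ => ((T σ).R⁻¹ : SO d).1) V.1.transpose τ := by
    simp only [SO.coe_inv]
    exact HasMatDerivAt.transpose h.1
  have hr := (hR.mul h.2).neg
  simp only [← TFG.r_inv] at hr
  have hinv := hasVelTFG_iff.1
    (show HasVelTFG (fun σ => (T σ)⁻¹) (V.1.transpose, -(_ + _)) τ from ⟨hR, hr⟩)
  have hmul := (hasVelTFG_iff.1 h).mul hinv
  simp only [TFG.toMat_mul_inv] at hmul
  have e := hmul.unique (hasMatDerivAt_const 1)
  have e' := congrArg ((T τ)⁻¹.toMat * ·) (eq_neg_of_add_eq_zero_right e)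
  simp only [← mul_assoc, TFG.toMat_inv_mul, one_mul, mul_neg] at e'
  rw [e'] at hinv
  exact hinv

/-- Differentiate `Rᵀ R = 1`. -/
theorem HasVelTFG.isTangentTFG {T : ℝ → TFG d n m} {V : TFGVel d n m} {τ : ℝ}
    (h : HasVelTFG T V τ) : IsTangentTFG (T τ) V := by
  have h1 := (HasMatDerivAt.transpose h.1).mul h.1
  have h2 : ∀ σ, (T σ).R.1.transpose * (T σ).R.1 = 1 := fun σ => by
    rw [← SO.coe_inv, TFG.coe_inv_mul]
  simp only [h2] at h1
  have e := h1.unique (hasMatDerivAt_const 1)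
  rw [IsTangentTFG, mem_Skew, SO.coe_inv, Matrix.transpose_mul, Matrix.transpose_transpose]
  exact eq_neg_of_add_eq_zero_left e

theorem HasVel.isTangent {χ : ℝ → MFG d n m s t} {V : MFGVel d n m s t} {τ : ℝ}
    (h : HasVel χ V τ) : IsTangent (χ τ) V :=
  ⟨h.1.isTangentTFG, fun j => (h.2.1 j).isTangentTFG, fun j => (h.2.2 j).isTangentTFG⟩

/-! ### Velocities of the factors against velocities of the blocks -/

section Blocks

variable {χ : ℝ → MFG d n m s t} {V : MFGVel d n m s t} {τ : ℝ}

theorem HasVel.lblock (h : HasVel χ V τ) (j : ℕ) :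
    HasMatDerivAt (fun σ => lblock (χ σ) j) (lblockVel (χ τ) V j) τ := by
  induction j with
  | zero => exact hasVelTFG_iff.1 h.1
  | succ i ih =>
    have hc : ∀ σ, MultiFrame.lblock (χ σ) (i + 1) =
        ((χ σ).lseq (i + 1)).toMat * MultiFrame.lblock (χ σ) i := fun σ => TFG.toMat_mul _ _
    simp only [hc]
    refine HasMatDerivAt.mul ?_ ih
    by_cases hi : i < s
    · simp only [lseq, lvel, hi, dite_true]
      exact hasVelTFG_iff.1 (h.2.1 ⟨i, hi⟩)
    · simp only [lseq, lvel, hi, dite_false]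
      have : velMat (0 : TFGVel d n m) = 0 := by simp [velMat]
      rw [this]
      exact hasMatDerivAt_const _

theorem HasVel.rblock (h : HasVel χ V τ) (j : ℕ) :
    HasMatDerivAt (fun σ => rblock (χ σ) j) (rblockVel (χ τ) V j) τ := by
  induction j with
  | zero => exact hasVelTFG_iff.1 h.1
  | succ i ih =>
    have hc : ∀ σ, MultiFrame.rblock (χ σ) (i + 1) =
        MultiFrame.rblock (χ σ) i * ((χ σ).rseq (i + 1)).toMat := fun σ => TFG.toMat_mul _ _
    simp only [hc]
    refine HasMatDerivAt.mul ih ?_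
    by_cases hi : i < t
    · simp only [rseq, rvel, hi, dite_true]
      exact hasVelTFG_iff.1 (h.2.2 ⟨i, hi⟩)
    · simp only [rseq, rvel, hi, dite_false]
      have : velMat (0 : TFGVel d n m) = 0 := by simp [velMat]
      rw [this]
      exact hasMatDerivAt_const _

/-- The velocity of a curve can be read off the diagonal blocks. -/
theorem hasVel_of_blocks (ht : IsTangent (χ τ) V)
    (hl : ∀ j ≤ s, HasMatDerivAt (fun σ => MultiFrame.lblock (χ σ) j) (lblockVel (χ τ) V j) τ)
    (hr : ∀ j ≤ t, HasMatDerivAt (fun σ => MultiFrame.rblock (χ σ) j) (rblockVel (χ τ) V j) τ) :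
    HasVel χ V τ := by
  refine ⟨hasVelTFG_iff.2 (hl 0 (Nat.zero_le _)), fun j => hasVelTFG_iff.2 ?_,
    fun j => hasVelTFG_iff.2 ?_⟩
  · obtain ⟨W, hW, -⟩ := isVelAt_lblockVel ht j.isLt.le
    have h1 := hl j j.isLt.le
    have h2 := hl (j + 1) j.isLt
    rw [hW] at h1
    -- A left factor is the quotient of two consecutive chains, so its derivative follows from
    -- theirs.
    have h3 := h2.mul (hasMatDerivAt_inv (T := fun σ => (χ σ).lchain j) (hasVelTFG_iff.2 h1))
    have e1 : ∀ σ, MultiFrame.lblock (χ σ) (j + 1) * ((χ σ).lchain j)⁻¹.toMat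
        = ((χ σ).left j).toMat := fun σ => by
      rw [MultiFrame.lblock, ← TFG.toMat_mul, lchain, mul_inv_cancel_right]
      simp [lseq]
    simp only [e1] at h3
    convert h3 using 1
    have e2 : (χ τ).lseq (j + 1) = (χ τ).left j := by simp [lseq]
    have e3 : lvel V (j + 1) = V.2.1 j := by simp [lvel]
    rw [lblockVel, hW, e2, e3, mul_neg, ← mul_assoc, ← mul_assoc, e1, add_mul, mul_assoc,
      MultiFrame.lblock, TFG.toMat_mul_inv, mul_one, mul_assoc]
    abel
  · obtain ⟨W, hW, -⟩ := isVelAt_rblockVel ht j.isLt.le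
    have h1 := hr j j.isLt.le
    have h2 := hr (j + 1) j.isLt
    rw [hW] at h1
    have h3 := (hasMatDerivAt_inv (T := fun σ => (χ σ).rchain j) (hasVelTFG_iff.2 h1)).mul h2
    have e1 : ∀ σ, ((χ σ).rchain j)⁻¹.toMat * MultiFrame.rblock (χ σ) (j + 1)
        = ((χ σ).right j).toMat := fun σ => by
      rw [MultiFrame.rblock, ← TFG.toMat_mul, rchain, inv_mul_cancel_left]
      simp [rseq]
    simp only [e1] at h3
    convert h3 using 1
    have e2 : (χ τ).rseq (j + 1) = (χ τ).right j := by simp [rseq]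
    have e3 : rvel V (j + 1) = V.2.2 j := by simp [rvel]
    rw [rblockVel, hW, e2, e3, neg_mul, mul_assoc, e1, mul_add, ← mul_assoc, ← mul_assoc,
      MultiFrame.rblock, TFG.toMat_inv_mul, one_mul]
    abel

end Blocks

/-! ### Flows compatible with automorphisms -/

/-- An automorphism followed by a right translation is onto. -/
theorem AutCompatible.surjective {F : MFG d n m s t → MFG d n m s t} (h : AutCompatible F) :
    Function.Surjective F := by
  obtain ⟨ψ, hψ⟩ := h
  intro y
  refine ⟨ψ.symm (y * (F 1)⁻¹), ?_⟩
  rw [hψ, ψ.apply_symm_apply, inv_mul_cancel_right]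

/-- Eliminates `ψ`, about whose dependence on time nothing is known; only the map itself remains to
be differentiated. -/
theorem AutCompatible.map_mul {F : MFG d n m s t → MFG d n m s t} (h : AutCompatible F)
    (a b : MFG d n m s t) : F (a * b) = F a * (F 1)⁻¹ * F b := by
  obtain ⟨ψ, hψ⟩ := h
  rw [hψ (a * b), hψ a, hψ b, _root_.map_mul]
  group

/-- Differentiating the compatibility of a flow with automorphisms along one block. -/
theorem affine_of_flow {Φ : ℝ → MFG d n m s t → MFG d n m s t}
    (haut : ∀ σ, AutCompatible (Φ σ)) (τ : ℝ) (B : MFG d n m s t →* TFG d n m)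
    (D : MFG d n m s t → Blk d n m)
    (hv : ∀ χ, ∃ V, D χ = velMat V)
    (hD : ∀ χ₀, HasMatDerivAt (fun σ => (B (Φ σ χ₀)).toMat) (D (Φ τ χ₀)) τ)
    (a b : MFG d n m s t) : D (a * b) = D a * (B b).toMat + (B a).toMat * D b
      - (B a).toMat * D 1 * (B b).toMat := by
  set E := Φ τ 1 with hE
  -- Time derivative of `AutCompatible.map_mul` at `τ`. By surjectivity, the values of the flow at
  -- `τ` may be replaced by arbitrary `x` and `y`.
  have key : ∀ x y, D (x * E⁻¹ * y) = D x * (B E)⁻¹.toMat * (B y).toMat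
      - (B x).toMat * ((B E)⁻¹.toMat * D E * (B E)⁻¹.toMat) * (B y).toMat
      + (B x).toMat * (B E)⁻¹.toMat * D y := by
    intro x y
    obtain ⟨x₀, rfl⟩ := (haut τ).surjective x
    obtain ⟨y₀, rfl⟩ := (haut τ).surjective y
    obtain ⟨V, hV⟩ := hv (Φ τ 1)
    have h1 := hD 1
    rw [hV] at h1
    have hinv := hasMatDerivAt_inv (T := fun σ => B (Φ σ 1)) (hasVelTFG_iff.2 h1)
    have hprod := ((hD x₀).mul hinv).mul (hD y₀)
    have e : ∀ σ, (B (Φ σ x₀)).toMat * (B (Φ σ 1))⁻¹.toMat * (B (Φ σ y₀)).toMat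
        = (B (Φ σ (x₀ * y₀))).toMat := fun σ => by
      rw [(haut σ).map_mul, map_mul, map_mul, map_inv, TFG.toMat_mul, TFG.toMat_mul]
    simp only [e] at hprod
    have e2 := (hD (x₀ * y₀)).unique hprod
    rw [(haut τ).map_mul] at e2
    rw [e2, hE, hV]
    noncomm_ring
  -- The choice `x = aE` cancels `E⁻¹`. The case `y = 1` then serves to eliminate the terms in `D (a
  -- * E)` and `D E`.
  have k1 := key (a * E) b
  have k2 := key (a * E) 1
  have eE : (B (a * E)).toMat * (B E)⁻¹.toMat = (B a).toMat := by
    rw [← TFG.toMat_mul, map_mul, mul_inv_cancel_right]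
  simp only [mul_inv_cancel_right, mul_one, map_one, TFG.toMat_one, ← mul_assoc, eE] at k1 k2
  have k3 : D (a * E) * (B E)⁻¹.toMat = D a + (B a).toMat * D E * (B E)⁻¹.toMat
      - (B a).toMat * D 1 := by
    rw [k2]; abel
  rw [k1, k3]
  noncomm_ring

/-- A time-varying flow compatible with automorphisms is generated by group affine fields. -/
theorem isGroupAffine_of_flow {U : Type*} {f : U → MFG d n m s t → MFGVel d n m s t}
    {u : ℝ → U} {Φ : ℝ → MFG d n m s t → MFG d n m s t} (hΦ : IsFlowOf f u Φ)
    (haut : ∀ τ, AutCompatible (Φ τ)) (τ : ℝ) (hc : Continuous (f (u τ))) :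
    IsGroupAffine fun _ : Unit => f (u τ) := by
  -- By surjectivity some trajectory passes through each point at time `τ`, and velocities of curves
  -- are tangent.
  have ht : ∀ χ, IsTangent χ (f (u τ) χ) := fun χ => by
    obtain ⟨χ₀, rfl⟩ := (haut τ).surjective χ
    exact (hΦ.2 τ χ₀).isTangent
  refine ⟨fun _ => hc, fun _ => ht, fun _ a b j hj => ?_, fun _ a b j hj => ?_⟩
  · exact affine_of_flow haut τ
      { toFun := fun χ => χ.lchain j, map_one' := lchain_one j,
        map_mul' := fun a b => lchain_mul a b j }
      (fun χ => lblockVel χ (f (u τ) χ) j)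
      (fun χ => (isVelAt_lblockVel (ht χ) hj).imp fun _ h => h.1)
      (fun χ₀ => (hΦ.2 τ χ₀).lblock j) a b
  · exact affine_of_flow haut τ
      { toFun := fun χ => χ.rchain j, map_one' := rchain_one j,
        map_mul' := fun a b => rchain_mul a b j }
      (fun χ => rblockVel χ (f (u τ) χ) j)
      (fun χ => (isVelAt_rblockVel (ht χ) hj).imp fun _ h => h.1)
      (fun χ₀ => (hΦ.2 τ χ₀).rblock j) a b

end MultiFrame

namespace MultiFrame

open TypeII

variable {d n m s t : ℕ}

/-! ### Exponentials of block triangular matrices -/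

open NormedSpace (exp)

open scoped Matrix.Norms.Operator Nat in
theorem hasSum_matExp {α : Type*} [Fintype α] [DecidableEq α] (A : Matrix α α ℝ) :
    HasSum (fun k : ℕ => ((k !)⁻¹ : ℝ) • A ^ k) (exp A) :=
  NormedSpace.exp_series_hasSum_exp' (𝕂 := ℝ) A

theorem blk_pow (θ : Matrix (Fin d) (Fin d) ℝ) (γ : Matrix (Fin d) (Fin n ⊕ Fin m) ℝ)
    (L : Matrix (Fin n ⊕ Fin m) (Fin n ⊕ Fin m) ℝ) (k : ℕ) :
    ∃ γ', blk θ γ L ^ k = blk (θ ^ k) γ' (L ^ k) := by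
  induction k with
  | zero => exact ⟨0, by simp [blk]⟩
  | succ k ih =>
    obtain ⟨γ', h⟩ := ih
    exact ⟨_, by rw [pow_succ, h, blk_mul, ← pow_succ, ← pow_succ]⟩

/-- Powers keep the triangular shape with powers on the diagonal, so the series can be compared
entry by entry. The corner needs no formula. -/
theorem exp_blk (θ : Matrix (Fin d) (Fin d) ℝ) (γ : Matrix (Fin d) (Fin n ⊕ Fin m) ℝ)
    (L : Matrix (Fin n ⊕ Fin m) (Fin n ⊕ Fin m) ℝ) :
    ∃ γ', exp (blk θ γ L) = blk (exp θ) γ' (exp L) := by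
  have h := hasSum_matExp (blk θ γ L)
  have hent : ∀ i j, HasSum (fun k : ℕ => ((k.factorial)⁻¹ : ℝ) * (blk θ γ L ^ k) i j)
      (exp (blk θ γ L) i j) := fun i j => by
    simpa using (Pi.hasSum.1 (Pi.hasSum.1 h i)) j
  have hent' : ∀ {α : Type} [Fintype α] [DecidableEq α] (A : Matrix α α ℝ) i j,
      HasSum (fun k : ℕ => ((k.factorial)⁻¹ : ℝ) * (A ^ k) i j) (exp A i j) :=
    fun A i j => by
      simpa using (Pi.hasSum.1 (Pi.hasSum.1 (hasSum_matExp A) i)) j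
  refine ⟨(exp (blk θ γ L)).toBlocks₁₂, ?_⟩
  refine (Matrix.fromBlocks_toBlocks _).symm.trans (Matrix.fromBlocks_inj.2 ⟨?_, rfl, ?_, ?_⟩)
  · ext i j
    refine (hent (Sum.inl i) (Sum.inl j)).unique ?_
    convert hent' θ i j using 3 with k
    obtain ⟨γ', h'⟩ := blk_pow θ γ L k
    rw [h']; rfl
  · ext i j
    refine (hent (Sum.inr i) (Sum.inl j)).unique ?_
    convert hasSum_zero with k
    · obtain ⟨γ', h'⟩ := blk_pow θ γ L k
      rw [h']; exact mul_zero _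
    · rfl
  · ext i j
    refine (hent (Sum.inr i) (Sum.inr j)).unique ?_
    convert hent' L i j using 3 with k
    obtain ⟨γ', h'⟩ := blk_pow θ γ L k
    rw [h']; rfl

theorem exp_mul_exp_neg {α : Type*} [Fintype α] [DecidableEq α] (A : Matrix α α ℝ) :
    exp A * exp (-A) = 1 := by
  rw [← Matrix.exp_add_of_commute _ _ (Commute.refl A).neg_right, add_neg_cancel]
  exact NormedSpace.exp_zero

theorem smul_mem_Skew (c : ℝ) {A : Matrix (Fin d) (Fin d) ℝ} (hA : A ∈ Skew d) :
    c • A ∈ Skew d := by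
  rw [mem_Skew] at hA ⊢
  rw [Matrix.transpose_smul, hA, smul_neg]

theorem exp_skew_mul_transpose {A : Matrix (Fin d) (Fin d) ℝ} (hA : A ∈ Skew d) :
    exp A * (exp A).transpose = 1 := by
  rw [← Matrix.exp_transpose, mem_Skew.1 hA, exp_mul_exp_neg]

/-- `exp A` is the square of the orthogonal matrix `exp (A/2)`, so its determinant is `(±1)²`. -/
theorem det_exp_skew {A : Matrix (Fin d) (Fin d) ℝ} (hA : A ∈ Skew d) : (exp A).det = 1 := by
  have hB : (1 / 2 : ℝ) • A ∈ Skew d := smul_mem_Skew _ hA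
  have h1 : exp A = exp ((1 / 2 : ℝ) • A) * exp ((1 / 2 : ℝ) • A) := by
    rw [← Matrix.exp_add_of_commute _ _ (Commute.refl _), ← add_smul]
    norm_num
  have h2 := congrArg Matrix.det (exp_skew_mul_transpose hB)
  rw [Matrix.det_mul, Matrix.det_transpose, Matrix.det_one] at h2
  rw [h1, Matrix.det_mul, h2]

open scoped Matrix.Norms.Operator in
theorem hasMatDerivAt_exp {α : Type*} [Fintype α] [DecidableEq α] (A : Matrix α α ℝ) (τ : ℝ) :
    HasMatDerivAt (fun σ : ℝ => exp (σ • A)) (A * exp (τ • A)) τ := by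
  intro i j
  have h : HasDerivAt (fun σ : ℝ => exp (σ • A)) (A * exp (τ • A)) τ :=
    hasDerivAt_exp_smul_const' A τ
  exact (LinearMap.toContinuousLinearMap
    (Matrix.entryLinearMap ℝ ℝ i j)).hasFDerivAt.comp_hasDerivAt τ h

theorem exp_smul_comm {α : Type*} [Fintype α] [DecidableEq α] (A : Matrix α α ℝ) (τ : ℝ) :
    A * exp (τ • A) = exp (τ • A) * A :=
  (((Commute.refl A).smul_right τ).exp_right).eq

/-! ### Flows on `TFG` -/

/-- `Θ` and `Ω` generate a flow `T ↦ e^{τΘ} T e^{τΩ}` on `TFG`. -/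
def IsGenerator (Θ Ω : Blk d n m) : Prop :=
  ∃ (θ ω : Matrix (Fin d) (Fin d) ℝ) (γ ρ : Matrix (Fin d) (Fin n ⊕ Fin m) ℝ)
    (L : Matrix (Fin n ⊕ Fin m) (Fin n ⊕ Fin m) ℝ), θ ∈ Skew d ∧ ω ∈ Skew d ∧
    Θ = blk θ γ (-L) ∧ Ω = blk ω ρ L

theorem blk_neg (θ : Matrix (Fin d) (Fin d) ℝ) (γ : Matrix (Fin d) (Fin n ⊕ Fin m) ℝ)
    (L : Matrix (Fin n ⊕ Fin m) (Fin n ⊕ Fin m) ℝ) : -blk θ γ L = blk (-θ) (-γ) (-L) := by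
  simp [blk, Matrix.fromBlocks_neg]

theorem blk_smul (c : ℝ) (θ : Matrix (Fin d) (Fin d) ℝ)
    (γ : Matrix (Fin d) (Fin n ⊕ Fin m) ℝ)
    (L : Matrix (Fin n ⊕ Fin m) (Fin n ⊕ Fin m) ℝ) :
    c • blk θ γ L = blk (c • θ) (c • γ) (c • L) := by
  simp [blk, Matrix.fromBlocks_smul]

/-- The pair `(Θ, -Θ)` generates conjugation by `e^{τΘ}`, the automorphism part of the flow. -/
theorem IsGenerator.conj {Θ Ω : Blk d n m} (h : IsGenerator Θ Ω) : IsGenerator Θ (-Θ) := by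
  obtain ⟨θ, ω, γ, ρ, L, hθ, hω, rfl, rfl⟩ := h
  exact ⟨θ, -θ, γ, -γ, L, hθ, neg_mem hθ, rfl, by rw [blk_neg, neg_neg]⟩

/-- The lower right block of the product is `e^{-τL} e^{τL} = 1`; the opposite signs of `L` keep the
flow inside TFG even though neither exponential lies in it. -/
theorem IsGenerator.exists_flow {Θ Ω : Blk d n m} (h : IsGenerator Θ Ω) (τ : ℝ)
    (T : TFG d n m) : ∃ T' : TFG d n m, T'.toMat = exp (τ • Θ) * T.toMat * exp (τ • Ω) := by
  obtain ⟨θ, ω, γ, ρ, L, hθ, hω, rfl, rfl⟩ := h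
  obtain ⟨γ', h1⟩ := exp_blk (τ • θ) (τ • γ) (τ • -L)
  obtain ⟨ρ', h2⟩ := exp_blk (τ • ω) (τ • ρ) (τ • L)
  have hθ' : τ • θ ∈ Skew d := smul_mem_Skew _ hθ
  have hω' : τ • ω ∈ Skew d := smul_mem_Skew _ hω
  let g := SO.ofMatrix _ (exp_skew_mul_transpose hθ') (det_exp_skew hθ')
  let g' := SO.ofMatrix _ (exp_skew_mul_transpose hω') (det_exp_skew hω')
  rw [blk_smul, blk_smul, h1, h2, toMat_eq, blk_mul, blk_mul, Matrix.mul_one, Matrix.mul_one]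
  refine ⟨TFG.ofRr (g * T.R * g')
    (g.1 * T.R.1 * ρ' + (g.1 * T.r + γ') * exp (τ • L)), ?_⟩
  rw [toMat_eq, TFG.ofRr_R, TFG.ofRr_r, blk_inj]
  refine ⟨rfl, rfl, ?_⟩
  have := exp_mul_exp_neg (-(τ • L))
  rw [neg_neg] at this
  rw [smul_neg, this]

/-- The flow `T ↦ e^{τΘ} T e^{τΩ}` on `TFG`. -/
noncomputable def expFlow {Θ Ω : Blk d n m} (h : IsGenerator Θ Ω) (τ : ℝ) (T : TFG d n m) :
    TFG d n m := (h.exists_flow τ T).choose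

theorem toMat_expFlow {Θ Ω : Blk d n m} (h : IsGenerator Θ Ω) (τ : ℝ) (T : TFG d n m) :
    (expFlow h τ T).toMat = exp (τ • Θ) * T.toMat * exp (τ • Ω) :=
  (h.exists_flow τ T).choose_spec

theorem exp_add_smul {α : Type*} [Fintype α] [DecidableEq α] (A : Matrix α α ℝ) (σ τ : ℝ) :
    exp ((σ + τ) • A) = exp (σ • A) * exp (τ • A) := by
  rw [add_smul, Matrix.exp_add_of_commute _ _ (((Commute.refl A).smul_left σ).smul_right τ)]

section ExpFlow

variable {Θ Ω : Blk d n m} (h : IsGenerator Θ Ω)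

theorem expFlow_zero (T : TFG d n m) : expFlow h 0 T = T := by
  apply TFG.toMat_injective
  have h0 : exp (0 : Blk d n m) = 1 := NormedSpace.exp_zero
  rw [toMat_expFlow, zero_smul, zero_smul, h0, one_mul, mul_one]

theorem expFlow_add (σ τ : ℝ) (T : TFG d n m) :
    expFlow h (σ + τ) T = expFlow h σ (expFlow h τ T) := by
  apply TFG.toMat_injective
  rw [toMat_expFlow, toMat_expFlow, toMat_expFlow, exp_add_smul, add_comm σ τ, exp_add_smul]
  simp only [mul_assoc]

theorem TFG.continuous_of_toMat {X : Type*} [TopologicalSpace X] {g : X → TFG d n m}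
    (hg : Continuous fun x => (g x).toMat) : Continuous g := by
  have hR : Continuous fun x => (g x).R :=
    Continuous.subtype_mk (continuous_matrix fun i j =>
      hg.matrix_elem (Sum.inl i) (Sum.inl j)) _
  have hr : Continuous fun x => (g x).r :=
    continuous_matrix fun i j => hg.matrix_elem (Sum.inl i) (Sum.inr j)
  have e : g = fun x => TFG.ofRr (g x).R (g x).r := funext fun x => (TFG.ofRr_self _).symm
  rw [e]
  exact TFG.continuous_ofRr hR hr

theorem continuous_expFlow (τ : ℝ) : Continuous (expFlow h τ) := by
  refine TFG.continuous_of_toMat ?_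
  simp only [toMat_expFlow]
  exact (continuous_const.matrix_mul TFG.continuous_toMat).matrix_mul continuous_const

theorem hasMatDerivAt_expFlow (τ : ℝ) (T : TFG d n m) :
    HasMatDerivAt (fun σ => (expFlow h σ T).toMat)
      (Θ * (expFlow h τ T).toMat + (expFlow h τ T).toMat * Ω) τ := by
  simp only [toMat_expFlow]
  have h1 := ((hasMatDerivAt_exp Θ τ).mul (hasMatDerivAt_const T.toMat)).mul
    (hasMatDerivAt_exp Ω τ)
  convert h1 using 1
  rw [exp_smul_comm Ω]
  simp only [mul_zero, add_zero, mul_assoc]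

theorem expFlow_conj_mul (h' : IsGenerator Θ (-Θ)) (τ : ℝ) (S T : TFG d n m) :
    expFlow h' τ (S * T) = expFlow h' τ S * expFlow h' τ T := by
  apply TFG.toMat_injective
  have e := exp_mul_exp_neg (-(τ • Θ))
  rw [neg_neg] at e
  rw [TFG.toMat_mul, toMat_expFlow, toMat_expFlow, toMat_expFlow, TFG.toMat_mul, smul_neg]
  simp only [mul_assoc]
  rw [← mul_assoc (exp (-(τ • Θ))), e, one_mul]

/-- Insert `e^{-τΘ} e^{τΘ} = 1` after `T`. -/
theorem expFlow_eq_conj (h' : IsGenerator Θ (-Θ)) (τ : ℝ) (T : TFG d n m) :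
    expFlow h τ T = expFlow h' τ T * expFlow h τ 1 := by
  apply TFG.toMat_injective
  have e := exp_mul_exp_neg (-(τ • Θ))
  rw [neg_neg] at e
  rw [TFG.toMat_mul, toMat_expFlow, toMat_expFlow, toMat_expFlow, TFG.toMat_one, smul_neg,
    mul_one]
  simp only [mul_assoc]
  rw [← mul_assoc (exp (-(τ • Θ))), e, one_mul]

end ExpFlow

/-! ### The flow of the explicit form -/

/-- World-frame parameters of all the chains. -/
def Params.chainΘ (p : Params d n m) (s t : ℕ) : Idx s t → Blk d n m
  | none => p.lΘ 0
  | some (Sum.inl j) => p.lΘ (j + 1)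
  | some (Sum.inr j) => p.rΘ (j + 1)

/-- Body-frame parameters of all the chains. -/
def Params.chainΩ (p : Params d n m) (s t : ℕ) : Idx s t → Blk d n m
  | none => p.rΩ 0
  | some (Sum.inl j) => p.lΩ (j + 1)
  | some (Sum.inr j) => p.rΩ (j + 1)

/-- The increments `lL i - lL (i+1)` telescope from `rL 0 = -lL 0`, which gives the signs required
of a generator. -/
theorem Params.lΩ_eq (p : Params d n m) (j : ℕ) :
    ∃ ω ∈ Skew d, ∃ ρ, p.lΩ j = blk ω ρ (-p.lL j) := by
  induction j with
  | zero => exact ⟨_, (p.rω 0).2, p.rρ 0, by rw [p.L_zero, neg_neg]; rfl⟩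
  | succ i ih =>
    obtain ⟨ω, hω, ρ, h⟩ := ih
    refine ⟨_, add_mem hω (p.lω (i + 1)).2, ρ + p.lρ (i + 1), ?_⟩
    rw [Params.lΩ, h, Params.lW, blk_add]
    congr 1
    abel

theorem Params.rΘ_eq (p : Params d n m) (j : ℕ) :
    ∃ θ ∈ Skew d, ∃ γ, p.rΘ j = blk θ γ (-p.rL j) := by
  induction j with
  | zero => exact ⟨_, (p.lθ 0).2, p.lγ 0, by rw [← p.L_zero]; rfl⟩
  | succ i ih =>
    obtain ⟨θ, hθ, γ, h⟩ := ih
    refine ⟨_, add_mem hθ (p.rθ (i + 1)).2, γ + p.rγ (i + 1), ?_⟩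
    rw [Params.rΘ, h, Params.rZ, blk_add]
    congr 1
    abel

theorem Params.isGenerator (p : Params d n m) (i : Idx s t) :
    IsGenerator (p.chainΘ s t i) (p.chainΩ s t i) := by
  rcases i with _ | j | j
  · exact ⟨_, _, _, _, p.rL 0, (p.lθ 0).2, (p.rω 0).2, by rw [← p.L_zero]; rfl, rfl⟩
  · obtain ⟨ω, hω, ρ, h⟩ := p.lΩ_eq (j + 1)
    exact ⟨_, ω, _, ρ, -p.lL (j + 1), (p.lθ _).2, hω, by rw [neg_neg]; rfl, h⟩
  · obtain ⟨θ, hθ, γ, h⟩ := p.rΘ_eq (j + 1)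
    exact ⟨θ, _, γ, _, p.rL (j + 1), hθ, (p.rω _).2, h, rfl⟩

/-- The flow of the explicit form. -/
noncomputable def explicitFlow (p : Params d n m) (τ : ℝ) (χ : MFG d n m s t) :
    MFG d n m s t := ofChain fun i => expFlow (p.isGenerator i) τ (χ.chain i)

theorem chain_explicitFlow (p : Params d n m) (τ : ℝ) (χ : MFG d n m s t) (i : Idx s t) :
    (explicitFlow p τ χ).chain i = expFlow (p.isGenerator i) τ (χ.chain i) := by
  rw [explicitFlow, chain_ofChain]

theorem hasMatDerivAt_chain_explicitFlow (p : Params d n m) (τ : ℝ) (χ : MFG d n m s t)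
    (i : Idx s t) : HasMatDerivAt (fun σ => ((explicitFlow p σ χ).chain i).toMat)
      (p.chainΘ s t i * ((explicitFlow p τ χ).chain i).toMat
        + ((explicitFlow p τ χ).chain i).toMat * p.chainΩ s t i) τ := by
  simp only [chain_explicitFlow]
  exact hasMatDerivAt_expFlow _ τ _

theorem hasVel_explicitFlow (p : Params d n m) (τ : ℝ) (χ : MFG d n m s t) :
    HasVel (fun σ => explicitFlow p σ χ) (explicitField p (explicitFlow p τ χ)) τ := by
  refine hasVel_of_blocks (isTangent_explicitField _ _) (fun j hj => ?_) (fun j hj => ?_)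
  · rw [lblockVel_explicitField _ _ hj]
    have h := hasMatDerivAt_chain_explicitFlow p τ χ (lidx j)
    simp only [chain_lidx _ hj] at h
    cases j with
    | zero => exact h
    | succ i =>
      simp only [lidx, Nat.lt_of_succ_le hj, dite_true] at h
      exact h
  · rw [rblockVel_explicitField _ _ hj]
    have h := hasMatDerivAt_chain_explicitFlow p τ χ (ridx j)
    simp only [chain_ridx _ hj] at h
    cases j with
    | zero => exact h
    | succ i =>
      simp only [ridx, Nat.lt_of_succ_le hj, dite_true] at h
      exact h

theorem autCompatible_explicitFlow (p : Params d n m) (τ : ℝ) :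
    AutCompatible (explicitFlow p τ : MFG d n m s t → _) := by
  have hc := fun i : Idx s t => (p.isGenerator i).conj
  -- Conjugation in every chain; the inverse runs the same flow for time `-τ`.
  let P : (Idx s t → TFG d n m) ≃ₜ* (Idx s t → TFG d n m) :=
    { toFun := fun g i => expFlow (hc i) τ (g i)
      invFun := fun g i => expFlow (hc i) (-τ) (g i)
      left_inv := fun g => funext fun i => by
        change expFlow (hc i) (-τ) (expFlow (hc i) τ (g i)) = g i
        rw [← expFlow_add, neg_add_cancel, expFlow_zero]
      right_inv := fun g => funext fun i => by
        change expFlow (hc i) τ (expFlow (hc i) (-τ) (g i)) = g i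
        rw [← expFlow_add, add_neg_cancel, expFlow_zero]
      map_mul' := fun g g' => funext fun i => expFlow_conj_mul (hc i) τ (g i) (g' i)
      continuous_toFun := continuous_pi fun i =>
        (continuous_expFlow (hc i) τ).comp (continuous_apply i)
      continuous_invFun := continuous_pi fun i =>
        (continuous_expFlow (hc i) (-τ)).comp (continuous_apply i) }
  let e := chainEquiv (TFG d n m) s t
  refine ⟨(e.trans P).trans e.symm, fun χ => chain_injective ?_⟩
  change _ = e (e.symm (P (e χ)) * explicitFlow p τ 1)
  rw [map_mul, e.apply_symm_apply]
  funext i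
  have h1 : (1 : MFG d n m s t).chain i = 1 := congrFun (map_one e) i
  change _ = expFlow (hc i) τ (χ.chain i) * (explicitFlow p τ 1).chain i
  rw [chain_explicitFlow, chain_explicitFlow, h1]
  exact expFlow_eq_conj _ _ _ _

theorem isFlowGroupAffine_explicitField {U : Type*} (p : U → Params d n m) :
    IsFlowGroupAffine (fun u => (explicitField (p u) : MFG d n m s t → _)) where
  continuous u := continuous_explicitField (p u)
  flow u := by
    refine ⟨explicitFlow (p u), fun χ => chain_injective (funext fun i => ?_),
      fun σ τ χ => chain_injective (funext fun i => ?_), hasVel_explicitFlow (p u),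
      autCompatible_explicitFlow (p u)⟩
    · rw [chain_explicitFlow, expFlow_zero]
    · rw [chain_explicitFlow, expFlow_add, chain_explicitFlow, chain_explicitFlow]

end MultiFrame

namespace MultiFrame

/-! ### The natural two-frame vector dynamics -/

section Natural

variable {d n m : ℕ}

theorem fromCols_add {α β β' : Type*} (A A' : Matrix α β ℝ) (B B' : Matrix α β' ℝ) :
    Matrix.fromCols A B + Matrix.fromCols A' B' = Matrix.fromCols (A + A') (B + B') := by
  ext i (j | j) <;> rfl

/-- The last columns of `r` are `R y`, with derivative `Ṙ y + R ẏ`; the terms with `rω 0` from the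
two summands cancel. -/
theorem coreVec_eq (p : Params d n m) (T : TFG d n m) : coreVec p T =
    Matrix.fromCols (naturalX p T) (coreFrame p T * T.y + T.R.1 * naturalY p T) := by
  rw [coreVec, TFG.r]
  conv_lhs => rw [← Matrix.fromBlocks_toBlocks (p.rL 0), ← Matrix.fromCols_toCols (p.lγ 0),
    ← Matrix.fromCols_toCols (p.rρ 0), Matrix.mul_fromCols, Matrix.mul_fromCols,
    Matrix.fromCols_mul_fromBlocks, fromCols_add, fromCols_add, fromCols_add]
  congr 1
  · simp only [naturalX, Matrix.mul_add, Matrix.mul_assoc]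
    abel
  · simp only [naturalY, coreFrame, Matrix.mul_add, Matrix.add_mul, Matrix.mul_neg,
      Matrix.mul_assoc, SO.mul_inv_mul]
    abel

theorem hasMatDerivAt_r_iff (p : Params d n m) (T : ℝ → TFG d n m) (τ : ℝ)
    (hR : HasMatDerivAt (fun σ => ((T σ).R : Matrix (Fin d) (Fin d) ℝ))
      (coreFrame p (T τ)) τ) :
    HasMatDerivAt (fun σ => (T σ).r) (coreVec p (T τ)) τ ↔
      HasMatDerivAt (fun σ => (T σ).x) (naturalX p (T τ)) τ ∧
      HasMatDerivAt (fun σ => (T σ).y) (naturalY p (T τ)) τ := by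
  rw [coreVec_eq]
  constructor
  · intro h
    refine ⟨fun i j => h i (Sum.inl j), ?_⟩
    have hRy : HasMatDerivAt (fun σ => (T σ).R.1 * (T σ).y)
        (coreFrame p (T τ) * (T τ).y + (T τ).R.1 * naturalY p (T τ)) τ :=
      fun i j => h i (Sum.inr j)
    -- The derivative of `y` is recovered from `y = R⁻¹ (R y)`.
    have hRi := HasMatDerivAt.transpose hR
    simp only [← SO.coe_inv] at hRi
    have h1 := hRi.mul hR
    simp only [TFG.coe_inv_mul] at h1
    have e := h1.unique (hasMatDerivAt_const 1)
    have h2 := hRi.mul hRy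
    simp only [SO.inv_mul_mul] at h2
    convert h2 using 1
    rw [Matrix.mul_add, SO.inv_mul_mul, ← Matrix.mul_assoc, ← Matrix.mul_assoc, ← add_assoc,
      ← Matrix.add_mul, e, Matrix.zero_mul, zero_add]
  · rintro ⟨hx, hy⟩ i (j | j)
    · exact hx i j
    · exact HasMatDerivAt.mul hR hy i j

end Natural

end MultiFrame

/-! ### The classification theorem -/

open MultiFrame
theorem mainTheorem1 (d n m s t : ℕ) {U : Type*}
    (f : U → MFG d n m s t → MFGVel d n m s t) :
    -- every system of the explicit form is group affine
    ((∃ p : U → Params d n m, ∀ u χ, f u χ = explicitField (p u) χ) →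
      IsGroupAffine f ∧ IsFlowGroupAffine f) ∧
    -- every group affine system has the explicit form
    ((d = 1 → n + m = 0 ∨ (s = 0 ∧ t = 0)) → (d = 2 → n + m ≤ 1) →
      (IsGroupAffine f →
        ∃ p : U → Params d n m, ∀ u χ, f u χ = explicitField (p u) χ) ∧
      (IsFlowGroupAffine f →
        ∃ p : U → Params d n m, ∀ u χ, f u χ = explicitField (p u) χ) ∧
      (∀ (u : ℝ → U) (Φ : ℝ → MFG d n m s t → MFG d n m s t),
        (∀ τ, Continuous (f (u τ))) → IsFlowOf f u Φ → (∀ τ, AutCompatible (Φ τ)) →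
        ∃ p : U → Params d n m, ∀ τ χ, f (u τ) χ = explicitField (p (u τ)) χ)) ∧
    -- the core equations are the natural two-frame vector dynamics
    (∀ (p : Params d n m) (T : ℝ → TFG d n m) (τ : ℝ),
      HasMatDerivAt (fun σ => ((T σ).R : Matrix (Fin d) (Fin d) ℝ)) (coreFrame p (T τ)) τ →
      (HasMatDerivAt (fun σ => (T σ).r) (coreVec p (T τ)) τ ↔
        HasMatDerivAt (fun σ => (T σ).x) (naturalX p (T τ)) τ ∧
        HasMatDerivAt (fun σ => (T σ).y) (naturalY p (T τ)) τ)) := by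
  refine ⟨?_, fun h1 h2 => ⟨fun h => ?_, fun h => ?_, fun u Φ hc hΦ haut => ?_⟩,
    hasMatDerivAt_r_iff⟩
  · rintro ⟨p, hp⟩
    obtain rfl : f = fun u => explicitField (p u) := funext fun u => funext (hp u)
    exact ⟨isGroupAffine_explicitField p, isFlowGroupAffine_explicitField p⟩
  · have key : ∀ u, ∃ p : Params d n m, ∀ χ, f u χ = explicitField p χ := fun u =>
      exists_explicitField_eq h1 h2 ⟨fun _ => h.continuous u, fun _ => h.tangent u,
        fun _ => h.affine_left u, fun _ => h.affine_right u⟩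
    exact Classical.skolem.1 key
  · have key : ∀ u, ∃ p : Params d n m, ∀ χ, f u χ = explicitField p χ := fun u => by
      -- Viewed as a flow for a constant signal, it gives the affine identity already at time `0`;
      -- the one-parameter group law plays no role.
      obtain ⟨Φ, h0, -, hvel, haut⟩ := h.flow u
      exact exists_explicitField_eq h1 h2
        (isGroupAffine_of_flow (u := fun _ => u) ⟨h0, hvel⟩ haut 0 (h.continuous u))
    exact Classical.skolem.1 key
  -- Parameters are chosen per input value rather than per time, so that they are functions of
  -- `u_τ`; values never taken by the signal get zero parameters.
  · have key : ∀ v, ∃ p : Params d n m, v ∈ Set.range u → ∀ χ, f v χ = explicitField p χ := by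
      intro v
      by_cases hv : v ∈ Set.range u
      · obtain ⟨τ, rfl⟩ := hv
        obtain ⟨p, hp⟩ := exists_explicitField_eq h1 h2
          (isGroupAffine_of_flow hΦ haut τ (hc τ))
        exact ⟨p, fun _ => hp⟩
      · exact ⟨⟨0, 0, 0, 0, 0, 0, 0, 0, 0, 0, neg_zero.symm⟩, fun h => absurd h hv⟩
    choose p hp using key
    exact ⟨p, fun τ => hp (u τ) ⟨τ, rfl⟩⟩
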